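/- **Setting.** Let $X$ be a complete, connected $C^\infty$ Riemannian manifold (second countable, without boundary) with Riemannian volume $\operatorname{vol}$, and $\operatorname{vol}(X)=\infty$. Fix $x_0\in X$, let $B(x,r)$ denote the closed ball of radius $r$ centred at $x$ and put $B(r):=B(x_0,r)$. Assume that there are $m\in\mathbb N=\{1,2,\dots\}$ and $C>0$ such that $\operatorname{vol}(B(\beta r))\le C\beta^m\operatorname{vol}(B(r))$ for all $r>0$, $\beta\ge1$. Let $\Gamma$ be the set of all infinite subsets $\gamma\subset X$ with $|\gamma\cap\Lambda|<\infty$ for each compact $\Lambda\subset X$, equipped with the vague topology (the coarsest topology making $\gamma\mapsto\sum_{x\in\gamma}\varphi(x)$ continuous for every continuous compactly supported $\varphi:X\to\mathbb R$) and its Borel $\sigma$-algebra. For $\alpha\ge1$ let $$\Theta_\alpha:=\{\gamma\in\Gamma \mid \exists K\in\mathbb N\ \forall r\in\mathbb N:\ |\gamma\cap B(r)|\le K\operatorname{vol}(B(r))^\alpha\},$$ with the relative topology and the trace $\sigma$-algebra. A numeration of $\gamma\in\Gamma$ is a sequence $(x_n)_{n\ge1}$ of pairwise distinct points with $\gamma=\{x_n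 : n\ge1\}$. Let $(p_t)_{t\ge0}$ be a Markov semigroup of kernels on $X$ (probability kernels with $p_0(x,\cdot)=\varepsilon_x$ and $p_{s+t}=p_sp_t$) whose Markov process has cadlag paths: for each $x\in X$ there is a probability measure $P^x$ on the space $D([0,\infty),X)$ of cadlag paths under which the coordinate process is a Markov process with transition function $(p_t)$ starting at $x$. **Assumptions.** Fix $\alpha\ge1$, and assume: 1. (no meeting) for all $x\ne y$ in $X$, for $P^x\otimes P^y$-almost every pair of paths $(\omega_1,\omega_2)$ one has $\omega_1(t)\ne\omega_2(t)$ for all $t>0$; 2. (uniform exit-time summability) there is $\epsilon>0$ such that for every $\delta>0$ $$\sum_{n=1}^\infty\ \sup_{x\in X}P^x\big(\tau_{B(x,\delta n^{1/(\alpha m)})^c}\le\epsilon\big)<\infty,$$ where $\tau_{B(x,r)^c}(\omega):=\inf\{t>0:\omega(t)\notin B(x,r)\}$ (and $\inf\varnothing=\infty$). **Theorem.** There is a Markov semigroup of kernels $(\mathbf P_t)_{t\ge0}$ on $\Theta_\alpha$ such that, for every $t\ge 0$, $\gamma\in\Theta_\alpha$ and every numeration $(x_n)$ of $\gamma$, $\mathbf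 P_t(\gamma,\cdot)$ is the image of the product measure $\bigotimes_{n}p_t(x_n,\cdot)$ under $(y_n)\mapsto\{y_n : n\ge1\}$ (defined on the sequences of distinct points without accumulation points). There is a time-homogeneous Markov process $$\mathbf M=(\mathbf\Omega,\mathbf F,(\mathbf F_t)_{t\ge0},(\boldsymbol\theta_t)_{t\ge0},(\mathbf P^\gamma)_{\gamma\in\Theta_\alpha},(\mathbf X_t)_{t\ge0})$$ on the state space $\Theta_\alpha$ with transition function $(\mathbf P_t)$ such that: * (a) $\mathbf M$ realizes the independent infinite particle process: if $(x_n)$ is a numeration of $\gamma\in\Theta_\alpha$ and $\omega_n$, $n\ge1$, are independent paths with distributions $P^{x_n}$, then almost surely, for all $t\ge0$, the points $\omega_n(t)$ are pairwise distinct and $\{\omega_n(t):n\ge1\}\in\Theta_\alpha$; and the process $t\mapsto\{\omega_n(t):n\ge1\}$ has the same distribution on path space as $(\mathbf X_t)$ under $\mathbf P^\gamma$. * (b) All paths of $\mathbf M$ are right continuous in $\Theta_\alpha$ with the vague topology, and have at each $t>0$ a left limit with respect to vague convergence in the space of multiple configurations satisfying the bound of $\Theta_\alpha$: the measures $\sum_{x\in\mathbf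 X_s}\varepsilon_x$ converge vaguely, as $s\uparrow t$, to a measure $\sum_{n\ge1}\varepsilon_{y_n}$, where only finitely many $y_n$ lie in each compact set and, for some $K\in\mathbb N$, $|\{n: y_n\in B(r)\}|\le K\operatorname{vol}(B(r))^\alpha$ for all $r\in\mathbb N$. * (c) If, moreover, the left limits of two independent particles do not meet either, i.e. for all $x\ne y$, for $P^x\otimes P^y$-almost every $(\omega_1,\omega_2)$ one has $\omega_1(t-)\ne\omega_2(t-)$ for all $t>0$, then $\mathbf M$ can be chosen so that, in addition to the above, all its paths are cadlag in $\Theta_\alpha$ with the vague topology (left limits at $t>0$ exist in $\Theta_\alpha$). -/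

import Mathlib

open MeasureTheory ProbabilityTheory Set Filter Topology Bundle Manifold
open scoped NNReal ENNReal

universe u

namespace InfiniteParticles

noncomputable section

/-! ## The Riemannian volume measure -/

section Volume

variable (d : ℕ) (X : Type u) [MetricSpace X] [ChartedSpace (EuclideanSpace ℝ (Fin d)) X]
  [RiemannianBundle (fun x : X => TangentSpace (𝓡 d) x)]

/-- `√det (g_ij)` at the point `y` of the coordinate space, where `g_ij = ⟨∂_i, ∂_j⟩` are the
coefficients of the Riemannian metric in the chart at `c`. -/
def chartDensity (c : X) (y : EuclideanSpace ℝ (Fin d)) : ℝ :=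
  let ψ : EuclideanSpace ℝ (Fin d) → X := (chartAt (EuclideanSpace ℝ (Fin d)) c).symm
  let frame : Fin d → TangentSpace (𝓡 d) (ψ y) := fun i =>
    mfderiv (𝓡 d) (𝓡 d) ψ y (EuclideanSpace.single i (1 : ℝ) : EuclideanSpace ℝ (Fin d))
  √(Matrix.det (Matrix.of fun i j => inner ℝ (frame i) (frame j)))

variable [MeasurableSpace X]

/-- The measure `√det (g_ij) dy` in the chart at `c`, carried over to `X`
(it lives on the domain of that chart). -/
def chartVolume (c : X) : Measure X :=
  ((volume.restrict (chartAt (EuclideanSpace ℝ (Fin d)) c).target).withDensity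
    (fun y => ENNReal.ofReal (chartDensity d X c y))).map
      (chartAt (EuclideanSpace ℝ (Fin d)) c).symm

/-- The set function `A ↦ ∫_{φ(A)} √det (g_ij) dy` for sets `A` contained in the domain of some
chart `φ` (the value does not depend on the chart), and `∞` for all other sets. -/
def localVolume (A : Set X) : ℝ≥0∞ :=
  ⨅ (c : X) (_ : A ⊆ (chartAt (EuclideanSpace ℝ (Fin d)) c).source), chartVolume d X c A

/-- The outer measure generated by the volumes of the sets that lie in a chart. -/
def volumeOuterMeasure : OuterMeasure X := OuterMeasure.boundedBy (localVolume d X)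

theorem le_caratheodory_volumeOuterMeasure :
    ‹MeasurableSpace X› ≤ (volumeOuterMeasure d X).caratheodory := by
  intro s hs
  refine OuterMeasure.boundedBy_caratheodory (fun t => ?_)
  refine le_iInf₂ fun c hc => ?_
  calc localVolume d X (t ∩ s) + localVolume d X (t \ s)
      ≤ chartVolume d X c (t ∩ s) + chartVolume d X c (t \ s) :=
        add_le_add (iInf₂_le c (inter_subset_left.trans hc))
          (iInf₂_le c (sdiff_subset.trans hc))
    _ = chartVolume d X c t := measure_inter_add_sdiff t hs

/-- The Riemannian volume measure: the measure on `X` which is `√det (g_ij) dy` in charts. -/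
def riemannianVolume : Measure X :=
  (volumeOuterMeasure d X).toMeasure (le_caratheodory_volumeOuterMeasure d X)

end Volume

/-! ## Configurations -/

section Config

variable (X : Type u)

/-- The configuration space: all infinite, locally finite subsets of `X`. -/
def Config [TopologicalSpace X] : Type u :=
  {γ : Set X // γ.Infinite ∧ ∀ K : Set X, IsCompact K → (γ ∩ K).Finite}

/-- The vague topology on the configuration space: the coarsest one for which all the maps
`γ ↦ ∑_{x ∈ γ} φ(x)`, with `φ` continuous and compactly supported, are continuous. -/
instance [TopologicalSpace X] : TopologicalSpace (Config X) :=
  ⨅ φ : CompactlySupportedContinuousMap X ℝ,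
    TopologicalSpace.induced (fun γ : Config X => ∑' x : γ.1, φ x) inferInstance

/-- The Borel `σ`-algebra of the vague topology. -/
instance [TopologicalSpace X] : MeasurableSpace (Config X) := borel _

instance [TopologicalSpace X] : BorelSpace (Config X) := ⟨rfl⟩

variable {X}

/-- `Θ_α`: the configurations for which the number of points in the closed ball of radius `r`
about `x₀` is at most `K vol(B(x₀, r))^α`, for some `K` and all `r = 1, 2, 3, …`. -/
def Theta [MetricSpace X] [MeasurableSpace X] (vol : Measure X) (x₀ : X) (α : ℝ) :
    Set (Config X) :=
  {γ | ∃ K : ℕ, ∀ r : ℕ, 1 ≤ r →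
    ((γ.1 ∩ Metric.closedBall x₀ r).encard : ℝ≥0∞) ≤ K * vol (Metric.closedBall x₀ r) ^ α}

/-- `x` enumerates the points of the configuration `γ`, each of them once. -/
def IsNumeration [TopologicalSpace X] (γ : Config X) (x : ℕ → X) : Prop :=
  Function.Injective x ∧ range x = γ.1

/-- Sequences of pairwise distinct points without accumulation points. -/
def goodSeq (X : Type u) [TopologicalSpace X] : Set (ℕ → X) :=
  {y | Function.Injective y ∧ ∀ K : Set X, IsCompact K → (range y ∩ K).Finite}

/-- The configuration formed by the members of a sequence. -/
def toConfig [TopologicalSpace X] (y : goodSeq X) : Config X :=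
  ⟨range y.1, infinite_range_of_injective y.2.1, y.2.2⟩

/-- The image on the configuration space of the product measure `⨂ ν_n`, considered as a measure
on the sequences of distinct points without accumulation points. -/
def configMeasure [TopologicalSpace X] [MeasurableSpace X] (ν : ℕ → Measure X) :
    Measure (Config X) :=
  ((Measure.infinitePi ν).comap (Subtype.val : goodSeq X → ℕ → X)).map toConfig

end Config

/-! ## Cadlag paths -/

section Paths

variable {S : Type u}

/-- Right continuous on `[0, ∞)` with left limits (in `S`) on `(0, ∞)`. -/
def IsCadlag [TopologicalSpace S] (w : ℝ≥0 → S) : Prop :=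
  (∀ t, ContinuousWithinAt w (Ici t) t) ∧ ∀ t, 0 < t → ∃ l, Tendsto w (𝓝[<] t) (𝓝 l)

/-- `D([0, ∞), S)`; as a subtype of `ℝ≥0 → S` it carries the cylinder `σ`-algebra. -/
abbrev CadlagPath (S : Type u) [TopologicalSpace S] : Type u := {w : ℝ≥0 → S // IsCadlag w}

/-- The filtration `σ(w(s), s ≤ t)` on `D([0, ∞), S)`. -/
def pathFiltration (S : Type u) [TopologicalSpace S] [MeasurableSpace S] :
    Filtration ℝ≥0 (inferInstance : MeasurableSpace (CadlagPath S)) where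
  seq t := ⨆ s : {s : ℝ≥0 // s ≤ t},
    MeasurableSpace.comap (fun w : CadlagPath S => w.1 s.1) inferInstance
  mono' := fun _ _ h => iSup_le fun s => le_iSup_of_le ⟨s.1, s.2.trans h⟩ le_rfl
  le' := fun _ => iSup_le fun s =>
    Measurable.comap_le ((measurable_pi_apply s.1).comp measurable_subtype_coe)

/-- The hitting time `inf {t > 0 : w(t) ∉ B(x, r)}` of the complement of the closed ball `B(x, r)`;
it is `∞` if the path stays in the ball. -/
def exitTime [MetricSpace S] (x : S) (r : ℝ) (w : ℝ≥0 → S) : ℝ≥0∞ :=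
  ⨅ (t : ℝ≥0) (_ : 0 < t ∧ w t ∉ Metric.closedBall x r), (t : ℝ≥0∞)

/-- The path `w` of configurations is cadlag in the vague topology with left limits allowed to have
multiple points: it is right continuous on `[0, ∞)`, and at every `t > 0` the measures
`∑_{x ∈ w(s)} ε_x`, `s ↑ t`, converge vaguely to some `∑_n ε_{y_n}`, where the points `y_n` need not
be distinct, only finitely many `y_n` lie in each compact set, and the number of `n` with
`y_n ∈ B(x₀, r)` is at most `K vol(B(x₀, r))^α`, for some `K` and all `r = 1, 2, 3, …`. -/
def IsCadlagMultiple [MetricSpace S] [MeasurableSpace S] (vol : Measure S) (x₀ : S) (α : ℝ)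
    (w : ℝ≥0 → Theta vol x₀ α) : Prop :=
  (∀ t, ContinuousWithinAt w (Ici t) t) ∧
  ∀ t, 0 < t → ∃ y : ℕ → S, (∀ K : Set S, IsCompact K → {n | y n ∈ K}.Finite) ∧
    (∃ K : ℕ, ∀ r : ℕ, 1 ≤ r → ({n | y n ∈ Metric.closedBall x₀ r}.encard : ℝ≥0∞) ≤
      K * vol (Metric.closedBall x₀ r) ^ α) ∧
    ∀ φ : CompactlySupportedContinuousMap S ℝ,
      Tendsto (fun s => ∑' x : (w s).1.1, φ x) (𝓝[<] t) (𝓝 (∑' n, φ (y n)))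

end Paths

/-! ## Markov processes -/

section Markov

/-- A Markov semigroup of kernels (with `p_0(x, ·) = ε_x`). -/
structure IsMarkovSemigroup {S : Type u} [MeasurableSpace S] (p : ℝ≥0 → Kernel S S) : Prop where
  isMarkovKernel : ∀ t, IsMarkovKernel (p t)
  zero : p 0 = Kernel.id
  add : ∀ s t, p (s + t) = p t ∘ₖ p s

/-- The Markov property of `(Z_t)` under `μ`, with respect to the filtration `ℱ` and with transition
function `p`: `μ(Z_{s+t} ∈ A | ℱ_s) = p_t(Z_s, A)` almost surely. -/
def HasMarkovProperty {Ω S : Type u} [MeasurableSpace S] {mΩ : MeasurableSpace Ω}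
    (ℱ : Filtration ℝ≥0 mΩ) (Z : ℝ≥0 → Ω → S) (p : ℝ≥0 → Kernel S S) (μ : Measure Ω) : Prop :=
  ∀ (s t : ℝ≥0) (A : Set S), MeasurableSet A →
    μ⟦Z (s + t) ⁻¹' A|ℱ s⟧ =ᵐ[μ] fun w => (p t (Z s w)).real A

/-- For every `x`, `P x` is the distribution on `D([0, ∞), S)` of a Markov process with transition
function `p` that starts at `x`. -/
structure IsCadlagMarkovFamily {S : Type u} [TopologicalSpace S] [MeasurableSpace S]
    (p : ℝ≥0 → Kernel S S) (P : S → Measure (CadlagPath S)) : Prop where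
  isProbabilityMeasure : ∀ x, IsProbabilityMeasure (P x)
  start : ∀ x, ∀ᵐ w ∂(P x), w.1 0 = x
  markov : ∀ x, HasMarkovProperty (pathFiltration S) (fun t w => w.1 t) p (P x)

/-- Time homogeneous Markov processes
`(Ω, F, (F_t), (θ_t), (P^γ)_{γ ∈ S}, (X_t))` with state space `S` and transition function `T`. -/
structure MarkovProcess (S : Type u) [MeasurableSpace S] (T : ℝ≥0 → Kernel S S) where
  /-- the sample space -/
  Ω : Type u
  /-- the `σ`-algebra of events -/
  events : MeasurableSpace Ω
  /-- the filtration -/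
  filtration : Filtration ℝ≥0 events
  /-- the shift operators -/
  shift : ℝ≥0 → Ω → Ω
  /-- the law of the process started at a point of the state space -/
  law : S → Measure Ω
  /-- the position at a given time -/
  X : ℝ≥0 → Ω → S
  adapted : ∀ t, Measurable[filtration t] (X t)
  measurable_shift : ∀ t, Measurable (shift t)
  X_shift : ∀ s t w, X s (shift t w) = X (s + t) w
  isProbabilityMeasure : ∀ γ, IsProbabilityMeasure (law γ)
  measurable_law : ∀ B : Set Ω, MeasurableSet B → Measurable fun γ => law γ B
  start : ∀ γ, ∀ᵐ w ∂(law γ), X 0 w = γ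
  transition : ∀ t γ A, MeasurableSet A → law γ (X t ⁻¹' A) = T t γ A
  markov : ∀ γ, HasMarkovProperty filtration X T (law γ)

attribute [instance] MarkovProcess.events

variable {X : Type u} [MetricSpace X] [MeasurableSpace X]

/-- Two independent particles that start at different points a.s. never meet. -/
def NeverMeet (P : X → Measure (CadlagPath X)) : Prop :=
  ∀ x y, x ≠ y → ∀ᵐ w ∂((P x).prod (P y)), ∀ t, 0 < t → w.1.1 t ≠ w.2.1 t

/-- For two independent particles that start at different points, a.s. the left limits of the two
paths are different at all times. -/
def LeftLimitsNeverMeet (P : X → Measure (CadlagPath X)) : Prop :=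
  ∀ x y, x ≠ y → ∀ᵐ w ∂((P x).prod (P y)), ∀ t, 0 < t →
    ¬ ∃ z, Tendsto w.1.1 (𝓝[<] t) (𝓝 z) ∧ Tendsto w.2.1 (𝓝[<] t) (𝓝 z)

/-- Uniform summability of exit probabilities: there is `ε > 0` such that, for every `δ > 0`,
`∑_{n ≥ 1} sup_x P^x(τ_{B(x, δ n^{1/(α m)})ᶜ} ≤ ε) < ∞`. -/
def ExitSummable (P : X → Measure (CadlagPath X)) (α : ℝ) (m : ℕ) : Prop :=
  ∃ ε : ℝ, 0 < ε ∧ ∀ δ : ℝ, 0 < δ →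
    ∑' n : ℕ, ⨆ x : X, P x {w | exitTime x (δ * ((n : ℝ) + 1) ^ (1 / (α * m))) w.1 ≤
      ENNReal.ofReal ε} < ∞

/-- The kernels `T t` on `Θ_α` are given by independent motion of the particles according to the
kernels `p t`: for each numeration `(x_n)` of `γ`, the measure `T t γ`, as a measure on the
configuration space, is the image of `⨂ p_t(x_n, ·)`. -/
def IsIndependentTransition {vol : Measure X} {x₀ : X} {α : ℝ} (p : ℝ≥0 → Kernel X X)
    (T : ℝ≥0 → Kernel (Theta vol x₀ α) (Theta vol x₀ α)) : Prop :=
  ∀ t (γ : Theta vol x₀ α) (x : ℕ → X), IsNumeration γ.1 x →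
    (T t γ).map Subtype.val = configMeasure fun n => p t (x n)

/-- `M` realizes the independent infinite particle process: for each `γ ∈ Θ_α` with numeration
`(x_n)`, and independent paths `w_n` with distributions `P^{x_n}`, a.s. the points `w_n(t)` are
pairwise distinct and form an element of `Θ_α` for all `t ≥ 0`, and the process
`t ↦ {w_n(t) : n}` has the same distribution as `M` started at `γ`. -/
def IsIndependentRealization {vol : Measure X} {x₀ : X} {α : ℝ}
    {T : ℝ≥0 → Kernel (Theta vol x₀ α) (Theta vol x₀ α)}
    (P : X → Measure (CadlagPath X)) (M : MarkovProcess (Theta vol x₀ α) T) : Prop :=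
  ∀ (γ : Theta vol x₀ α) (x : ℕ → X), IsNumeration γ.1 x →
    ∃ Y : (ℕ → CadlagPath X) → ℝ≥0 → Theta vol x₀ α, Measurable Y ∧
      (∀ᵐ w ∂(Measure.infinitePi fun n => P (x n)), ∀ t,
        IsNumeration (Y w t).1 fun n => (w n).1 t) ∧
      (Measure.infinitePi fun n => P (x n)).map Y = (M.law γ).map fun w t => M.X t w

end Markov

end

end InfiniteParticles

set_option linter.unusedSectionVars false

/-! Almost surely, far away particles do not get far compared with their initial distance from `x₀`.
Doubling bounds `vol(B(R))^α` by a constant times `R^(αm)`, so a configuration in `Θ_α`, numbered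
roughly by distance, eventually has its `n`-th point at distance at least `c (n+1)^(1/(αm))`
(`exists_numeration_dist_ge`). By the Markov property at the times `jε`, the probability that a
particle moves by more than a fixed fraction of its initial distance during `[jε, (j+1)ε]` is at
most a supremum as in the exit-time assumption, and these suprema are summable over the particles.
Borel-Cantelli then gives `ae_finite_setOf_displacement`: up to any time `T`, all but finitely many
particles stay within half their initial distance of their starting points.

The rest of the regularity is deterministic. A particle in `B(r)` is exceptional or started in
`B(2r)`, so doubling preserves the bound of `Θ_α`, both for the positions and for their left limits.
For `φ` of compact support only a fixed finite set of particles can reach the support before `T`;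
hence `t ↦ ∑ φ(w_n(t))` is locally in time a finite sum and inherits right continuity and left
limits from the particles. Left limits of different particles may coincide, which is why multiple
configurations appear; if they never coincide the limit is again in `Θ_α`. Distinctness of all
particles follows from the no-meeting assumption applied to countably many pairs.

The law started at `γ` is the image of `⨂ P^{x_n}` on a space of regular paths. It does not depend
on the numeration, since events of configurations correspond to permutation invariant sets of
sequences (`numerations`), and it is measurable in `γ` because a numeration can be chosen
measurably. Its Markov property is that of a product of independent Markov processes
(`measure_infinitePi_inter`), transported to configurations; the transition kernels are the
marginals of these laws, and their semigroup property is read off from the Markov property. -/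

namespace InfiniteParticles

/-! ### Local finiteness of the Riemannian volume -/

section VolumeFinite

variable {d : ℕ} {X : Type u} [MetricSpace X] [ChartedSpace (EuclideanSpace ℝ (Fin d)) X]
  [RiemannianBundle (fun x : X => TangentSpace (𝓡 d) x)]

theorem isContinuousRiemannianBundle_tangent
    [IsManifold (𝓡 d) 1 X]
    [h : IsContMDiffRiemannianBundle (𝓡 d) ((⊤ : ℕ∞) : WithTop ℕ∞) (EuclideanSpace ℝ (Fin d))
      (fun x : X => TangentSpace (𝓡 d) x)] :
    IsContinuousRiemannianBundle (EuclideanSpace ℝ (Fin d))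
      (fun x : X => TangentSpace (𝓡 d) x) := by
  obtain ⟨g, hg, h'⟩ := h.exists_contMDiff
  exact ⟨g, hg.continuous, h'⟩

theorem eventually_norm_mfderiv_chartAt_symm_single_le [IsManifold (𝓡 d) 1 X]
    [IsContinuousRiemannianBundle (EuclideanSpace ℝ (Fin d))
      (fun x : X => TangentSpace (𝓡 d) x)] (c : X) :
    ∃ K : ℝ, ∀ᶠ y in 𝓝 (chartAt (EuclideanSpace ℝ (Fin d)) c c), ∀ i : Fin d,
      ‖(mfderiv (𝓡 d) (𝓡 d) (chartAt (EuclideanSpace ℝ (Fin d)) c).symm y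
        (EuclideanSpace.single i (1 : ℝ) : EuclideanSpace ℝ (Fin d)) :
          TangentSpace (𝓡 d) ((chartAt (EuclideanSpace ℝ (Fin d)) c).symm y))‖ ≤ K := by
  -- The tangent spaces of the coordinate space get the Euclidean norm, in which the coordinate
  -- vectors are unit vectors.
  let (x : EuclideanSpace ℝ (Fin d)) : NormedAddCommGroup (TangentSpace (𝓡 d) x) :=
    normedAddCommGroupTangentSpaceVectorSpace x
  let (x : EuclideanSpace ℝ (Fin d)) : NormedSpace ℝ (TangentSpace (𝓡 d) x) :=
    normedSpaceTangentSpaceVectorSpace x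
  obtain ⟨K, hK, h⟩ := eventually_norm_mfderivWithin_symm_extChartAt_lt (𝓡 d) c
  refine ⟨K, ?_⟩
  simp only [mfld_simps, nhdsWithin_univ, mfderivWithin_univ] at h
  filter_upwards [h] with y hy i
  refine (ContinuousLinearMap.le_opNorm _ _).trans ?_
  have : ‖(EuclideanSpace.single i (1 : ℝ) : EuclideanSpace ℝ (Fin d))‖ = 1 := by simp
  calc _ ≤ K * ‖(EuclideanSpace.single i (1 : ℝ) : EuclideanSpace ℝ (Fin d))‖ :=
        mul_le_mul_of_nonneg_right hy.le (norm_nonneg _)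
    _ = K := by rw [this, mul_one]

/-- By Cauchy-Schwarz the entries of the Gram matrix are bounded by `K²` near the centre, and the
Leibniz formula bounds its determinant by `d! (K²)^d`. -/
theorem eventually_chartDensity_le [IsManifold (𝓡 d) 1 X]
    [IsContinuousRiemannianBundle (EuclideanSpace ℝ (Fin d))
      (fun x : X => TangentSpace (𝓡 d) x)] (c : X) :
    ∃ M : ℝ, ∀ᶠ y in 𝓝 (chartAt (EuclideanSpace ℝ (Fin d)) c c), chartDensity d X c y ≤ M := by
  obtain ⟨K, hK⟩ := eventually_norm_mfderiv_chartAt_symm_single_le (d := d) c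
  refine ⟨√((Fintype.card (Fin d)).factorial • (K * K) ^ Fintype.card (Fin d)), ?_⟩
  filter_upwards [hK] with y hy
  refine Real.sqrt_le_sqrt ((le_abs_self _).trans ?_)
  refine Matrix.det_le (abv := AbsoluteValue.abs) fun i j => ?_
  rw [Matrix.of_apply, AbsoluteValue.abs_apply]
  exact (abs_real_inner_le_norm _ _).trans
    (mul_le_mul (hy i) (hy j) (norm_nonneg _) ((norm_nonneg _).trans (hy i)))

theorem riemannianVolume_le_chartVolume [MeasurableSpace X] (c : X) {A : Set X}
    (hA : MeasurableSet A) (hc : A ⊆ (chartAt (EuclideanSpace ℝ (Fin d)) c).source) :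
    riemannianVolume d X A ≤ chartVolume d X c A := by
  rw [riemannianVolume, toMeasure_apply _ _ hA]
  exact (OuterMeasure.boundedBy_le A).trans (iInf₂_le c hc)

/-- A small ball lies in one chart, in a region where the density is bounded. One such ball
suffices: doubling passes finiteness on to all radii. -/
theorem exists_riemannianVolume_closedBall_lt_top
    [IsManifold (𝓡 d) ((⊤ : ℕ∞) : WithTop ℕ∞) X]
    [IsContMDiffRiemannianBundle (𝓡 d) ((⊤ : ℕ∞) : WithTop ℕ∞) (EuclideanSpace ℝ (Fin d))
      (fun x : X => TangentSpace (𝓡 d) x)] [MeasurableSpace X] [BorelSpace X] (c : X) :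
    ∃ r : ℝ, 0 < r ∧ riemannianVolume d X (Metric.closedBall c r) < ∞ := by
  have : IsManifold (𝓡 d) 1 X := IsManifold.of_le (n := ((⊤ : ℕ∞) : WithTop ℕ∞)) (by simp)
  have := isContinuousRiemannianBundle_tangent (d := d) (X := X)
  obtain ⟨M, hM⟩ := eventually_chartDensity_le (d := d) c
  set φ := chartAt (EuclideanSpace ℝ (Fin d)) c with hφ
  have hcs : c ∈ φ.source := mem_chart_source _ c
  obtain ⟨ρ, hρ, hball⟩ := Metric.eventually_nhds_iff_ball.1 hM
  have h1 : φ.source ∩ φ ⁻¹' (Metric.ball (φ c) ρ) ∈ 𝓝 c :=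
    inter_mem (φ.open_source.mem_nhds hcs)
      ((φ.continuousAt hcs).preimage_mem_nhds (Metric.ball_mem_nhds _ hρ))
  obtain ⟨r, hr, hsub⟩ := Metric.nhds_basis_closedBall.mem_iff.1 h1
  refine ⟨r, hr, (riemannianVolume_le_chartVolume c Metric.isClosed_closedBall.measurableSet
    (hsub.trans inter_subset_left)).trans_lt ?_⟩
  rw [chartVolume, ← hφ]
  by_cases hm : AEMeasurable φ.symm ((volume.restrict φ.target).withDensity
    (fun y => ENNReal.ofReal (chartDensity d X c y)))
  · rw [Measure.map_apply_of_aemeasurable hm Metric.isClosed_closedBall.measurableSet,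
      withDensity_apply' _ _, Measure.restrict_restrict₀' φ.open_target.nullMeasurableSet]
    set S := φ.symm ⁻¹' Metric.closedBall c r ∩ φ.target with hS
    have hSb : S ⊆ Metric.ball (φ c) ρ := by
      rintro y ⟨hy, hyt⟩
      simpa [φ.right_inv hyt] using (hsub hy).2
    calc ∫⁻ y in S, ENNReal.ofReal (chartDensity d X c y)
        ≤ ∫⁻ y in Metric.ball (φ c) ρ, ENNReal.ofReal (chartDensity d X c y) :=
          lintegral_mono_set hSb
      _ ≤ ∫⁻ y in Metric.ball (φ c) ρ, ENNReal.ofReal M :=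
          setLIntegral_mono measurable_const fun y hy => ENNReal.ofReal_le_ofReal (hball y hy)
      _ < ∞ := by
          rw [setLIntegral_const]
          exact ENNReal.mul_lt_top ENNReal.ofReal_lt_top measure_ball_lt_top
  -- The image of a measure under a map that is not a.e. measurable is zero by convention.
  · rw [Measure.map_of_not_aemeasurable hm]
    simp

end VolumeFinite

/-! ### Vague convergence of configurations -/

section VagueTopology

variable {X : Type u} [TopologicalSpace X]

/-- The integral `∑_{x ∈ γ} φ(x)`. -/
noncomputable def vagueSum (φ : CompactlySupportedContinuousMap X ℝ) (γ : Config X) : ℝ :=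
  ∑' x : γ.1, φ x

theorem continuous_vagueSum (φ : CompactlySupportedContinuousMap X ℝ) :
    Continuous (vagueSum φ) :=
  continuous_iInf_dom (i := φ) continuous_induced_dom

theorem tendsto_config_iff {β : Type*} {l : Filter β} {F : β → Config X} {γ : Config X} :
    Tendsto F l (𝓝 γ) ↔ ∀ φ, Tendsto (fun b => vagueSum φ (F b)) l (𝓝 (vagueSum φ γ)) := by
  rw [nhds_iInf, tendsto_iInf]
  refine forall_congr' fun φ => ?_
  rw [nhds_induced, tendsto_comap_iff]
  rfl

theorem finite_inter_tsupport (φ : CompactlySupportedContinuousMap X ℝ) (γ : Config X) :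
    (γ.1 ∩ tsupport φ).Finite :=
  γ.2.2 _ φ.hasCompactSupport

theorem support_subset_inter_tsupport (φ : CompactlySupportedContinuousMap X ℝ) (γ : Config X) :
    Function.support (γ.1.indicator φ) ⊆ γ.1 ∩ tsupport φ := by
  rw [Set.support_indicator]
  exact inter_subset_inter_right _ (subset_tsupport _)

theorem summable_indicator_config (φ : CompactlySupportedContinuousMap X ℝ) (γ : Config X) :
    Summable (γ.1.indicator φ) :=
  summable_of_hasFiniteSupport ((finite_inter_tsupport φ γ).subset
    (support_subset_inter_tsupport φ γ))

theorem vagueSum_eq_tsum_indicator (φ : CompactlySupportedContinuousMap X ℝ) (γ : Config X) :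
    vagueSum φ γ = ∑' x, γ.1.indicator φ x :=
  tsum_subtype γ.1 φ

/-- Approximation of test functions is measured against a bump `χ`, because the number of points
seen by `φ - ψ` is not bounded uniformly in `γ`, while the sum of `χ` controls it locally. -/
theorem abs_vagueSum_sub_le {φ ψ χ : CompactlySupportedContinuousMap X ℝ} {ε : ℝ}
    (h : ∀ x, |φ x - ψ x| ≤ ε * χ x) (γ : Config X) :
    |vagueSum φ γ - vagueSum ψ γ| ≤ ε * vagueSum χ γ := by
  simp only [vagueSum_eq_tsum_indicator]
  rw [← (summable_indicator_config φ γ).tsum_sub (summable_indicator_config ψ γ), ← tsum_mul_left]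
  have hs := (summable_indicator_config χ γ).mul_left ε
  have key : ∀ x, |γ.1.indicator φ x - γ.1.indicator ψ x| ≤ ε * γ.1.indicator χ x := by
    intro x
    by_cases hx : x ∈ γ.1
    · simpa [hx] using h x
    · simp [hx]
  exact tsum_of_norm_bounded
    (f := fun x => γ.1.indicator φ x - γ.1.indicator ψ x) hs.hasSum key

theorem vagueSum_eq_tsum_of_isNumeration {γ : Config X} {y : ℕ → X} (h : IsNumeration γ y)
    (φ : CompactlySupportedContinuousMap X ℝ) : vagueSum φ γ = ∑' n, φ (y n) := by
  rw [vagueSum, ← h.2]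
  exact tsum_range φ h.1

end VagueTopology

/-! ### Countably many test functions determine the vague topology -/

section SecondCountable

variable {X : Type u} [TopologicalSpace X] [T2Space X] [LocallyCompactSpace X]
  [SecondCountableTopology X]

/-- A function supported in a member `K j` of a compact exhaustion is approximated uniformly on `K
j` from a countable dense subset of the functions supported there. A bump equal to 1 on `K j` turns
the uniform error `ε` into `ε χ`, with `χ` chosen before `ε`. -/
theorem exists_countable_compactlySupported_approx :
    ∃ D : Set (CompactlySupportedContinuousMap X ℝ), D.Countable ∧
      ∀ φ : CompactlySupportedContinuousMap X ℝ, ∃ χ ∈ D, ∀ ε : ℝ, 0 < ε →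
        ∃ f ∈ D, ∀ x, |φ x - f x| ≤ ε * χ x := by
  let K := CompactExhaustion.choice X
  have hχ : ∀ j, ∃ χ : CompactlySupportedContinuousMap X ℝ, (∀ x ∈ K j, χ x = 1) ∧ ∀ x, 0 ≤ χ x := by
    intro j
    obtain ⟨f, h1, -, hc, h01⟩ := exists_continuous_one_zero_of_isCompact
      (K.isCompact j) isClosed_empty (disjoint_empty _)
    exact ⟨⟨f, hc⟩, h1, fun x => (h01 x).1⟩
  choose χ hχ1 hχ0 using hχ
  let S : ℕ → Set C(X, ℝ) := fun j => {f | tsupport f ⊆ K j}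
  let toCc : ∀ j, S j → CompactlySupportedContinuousMap X ℝ := fun j f =>
    ⟨f.1, (K.isCompact j).of_isClosed_subset (isClosed_tsupport _) f.2⟩
  have hd : ∀ j, ∃ s : Set (S j), s.Countable ∧ Dense s := fun j =>
    TopologicalSpace.exists_countable_dense _
  choose s hs hsd using hd
  refine ⟨range χ ∪ ⋃ j, toCc j '' s j, (countable_range _).union
    (countable_iUnion fun j => (hs j).image _), fun φ => ?_⟩
  obtain ⟨j, hj⟩ := K.exists_superset_of_isCompact φ.hasCompactSupport
  refine ⟨χ j, Or.inl (mem_range_self _), fun ε hε => ?_⟩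
  have hφ : φ.toContinuousMap ∈ S j := hj
  have hU : {f : S j | ∀ x ∈ K j, |φ x - f.1 x| < ε} ∈ 𝓝 (⟨φ.toContinuousMap, hφ⟩ : S j) := by
    have h := (ContinuousMap.tendsto_iff_forall_isCompact_tendstoUniformlyOn
      (f := φ.toContinuousMap) (F := fun f : C(X, ℝ) => f) (p := 𝓝 φ.toContinuousMap)).1 tendsto_id (K j)
      (K.isCompact j)
    rw [Metric.tendstoUniformlyOn_iff] at h
    have h2 := h ε hε
    exact (continuous_subtype_val.tendsto (⟨φ.toContinuousMap, hφ⟩ : S j)).eventually h2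
  obtain ⟨f, hfs, hf⟩ := (hsd j).inter_nhds_nonempty hU
  refine ⟨toCc j f, Or.inr (mem_iUnion.2 ⟨j, mem_image_of_mem _ hfs⟩), fun x => ?_⟩
  by_cases hx : x ∈ K j
  · rw [hχ1 j x hx, mul_one]
    exact (hf x hx).le
  · have h1 : φ x = 0 := image_eq_zero_of_notMem_tsupport fun h => hx (hj h)
    have h2 : toCc j f x = 0 := image_eq_zero_of_notMem_tsupport fun h => hx (f.2 h)
    rw [h1, h2, sub_zero, abs_zero]
    exact mul_nonneg hε.le (hχ0 j x)

/-- The defining infimum of topologies is uncountable, but the sums over a countable family `D`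
already induce it; hence the Borel σ-algebra is pulled back from the second countable space `D → ℝ`.
-/
theorem measurable_config_iff {Ω : Type*} [MeasurableSpace Ω] {F : Ω → Config X} :
    Measurable F ↔ ∀ φ, Measurable fun ω => vagueSum φ (F ω) := by
  refine ⟨fun hF φ => (continuous_vagueSum φ).measurable.comp hF, fun h => ?_⟩
  obtain ⟨D, hD, hDa⟩ := exists_countable_compactlySupported_approx (X := X)
  have := hD.to_subtype
  let Φ : Config X → D → ℝ := fun γ f => vagueSum f.1 γ
  have hind : IsInducing Φ := by
    refine ⟨le_antisymm ?_ ?_⟩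
    · rw [← continuous_iff_le_induced]
      exact continuous_pi fun f => continuous_vagueSum f.1
    · refine le_iInf fun φ => ?_
      rw [← continuous_iff_le_induced]
      obtain ⟨χ, hχ, happ⟩ := hDa φ
      -- From here on continuity refers to the topology induced by `Φ`, for which only the sums over
      -- `D` are known to be continuous.
      let := TopologicalSpace.induced Φ inferInstance
      have hc : ∀ f ∈ D, Continuous (vagueSum (X := X) f) := fun f hf =>
        (continuous_apply (A := fun _ : D => ℝ) (⟨f, hf⟩ : D)).comp
          (continuous_induced_dom (f := Φ))
      change Continuous (vagueSum (X := X) φ)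
      rw [continuous_iff_continuousAt]
      intro γ₀
      -- Near `γ₀` the sum of `χ` stays below a constant, so dividing `ε` by this constant makes the
      -- approximation by the sum of `f` uniform there.
      refine continuousAt_of_locally_uniform_approx_of_continuousAt fun u hu => ?_
      obtain ⟨ε, hε, hεu⟩ := Metric.mem_uniformity_dist.1 hu
      have hM : 0 < |vagueSum χ γ₀| + 1 := by positivity
      have hn : {γ | vagueSum χ γ < |vagueSum χ γ₀| + 1} ∈ 𝓝 γ₀ :=
        (hc χ hχ).continuousAt.preimage_mem_nhds
          (Iio_mem_nhds ((le_abs_self _).trans_lt (lt_add_one _)))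
      obtain ⟨f, hf, hfa⟩ := happ (ε / (|vagueSum χ γ₀| + 1)) (div_pos hε hM)
      refine ⟨_, hn, vagueSum f, (hc f hf).continuousAt, fun γ hγ => hεu ?_⟩
      rw [Real.dist_eq]
      calc _ ≤ ε / (|vagueSum χ γ₀| + 1) * vagueSum χ γ := abs_vagueSum_sub_le hfa γ
        _ < ε / (|vagueSum χ γ₀| + 1) * (|vagueSum χ γ₀| + 1) :=
          mul_lt_mul_of_pos_left hγ (div_pos hε hM)
        _ = ε := div_mul_cancel₀ _ hM.ne'
  have hb : (borel (Config X)) = (MeasurableSpace.pi : MeasurableSpace (D → ℝ)).comap Φ := by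
    rw [hind.eq_induced, borel_comap, BorelSpace.measurable_eq (α := D → ℝ)]
  change @Measurable _ _ _ (borel (Config X)) F
  rw [hb, measurable_comap_iff]
  exact measurable_pi_lambda _ fun f => h f.1

end SecondCountable

/-! ### Measurability of the number of points in a Borel set -/

section Counting

variable {X : Type u} [MetricSpace X] [LocallyCompactSpace X] [SecondCountableTopology X]

theorem countable_config (γ : Config X) : γ.1.Countable := by
  have h : γ.1 = ⋃ j, γ.1 ∩ CompactExhaustion.choice X j := by
    rw [← inter_iUnion, CompactExhaustion.iUnion_eq, inter_univ]
  rw [h]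
  exact countable_iUnion fun j =>
    (γ.2.2 _ ((CompactExhaustion.choice X).isCompact j)).countable

variable [MeasurableSpace X] [BorelSpace X]

/-- The functions `g n` converge pointwise to the indicator of `V` and are supported in its compact
closure, so their sums run over one finite set of points and converge to the count. -/
theorem measurable_encard_inter_isOpen {V : Set X} (hV : IsOpen V) (hVc : IsCompact (closure V)) :
    Measurable fun γ : Config X => ((γ.1 ∩ V).encard : ℝ≥0∞) := by
  have hδ : ∀ n : ℕ, (0 : ℝ) < 1 / ((n : ℝ) + 1) := fun n => Nat.one_div_pos_of_nat
  let g : ℕ → X → ℝ := fun n x => 1 - (thickenedIndicator (hδ n) Vᶜ x : ℝ)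
  have hsupp : ∀ n, tsupport (g n) ⊆ closure V := fun n => by
    refine closure_mono fun x hx => ?_
    by_contra hxV
    refine hx ?_
    simp only [g]
    rw [thickenedIndicator_one (hδ n) Vᶜ hxV]
    simp
  have hgc : ∀ n, Continuous (g n) := fun n =>
    continuous_const.sub (NNReal.continuous_coe.comp (thickenedIndicator (hδ n) Vᶜ).continuous)
  let φ : ℕ → CompactlySupportedContinuousMap X ℝ := fun n =>
    ⟨⟨g n, hgc n⟩, hVc.of_isClosed_subset (isClosed_tsupport _) (hsupp n)⟩
  have hlim : ∀ x, Tendsto (fun n => φ n x) atTop (𝓝 (V.indicator 1 x)) := by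
    intro x
    have h := tendsto_pi_nhds.1 (thickenedIndicator_tendsto_indicator_closure hδ
      tendsto_one_div_add_atTop_nhds_zero_nat Vᶜ) x
    have h2 := ((NNReal.continuous_coe.tendsto _).comp h).const_sub 1
    have h3 : (1 : ℝ) - ((closure Vᶜ).indicator (fun _ => (1 : ℝ≥0)) x : ℝ≥0) =
        V.indicator 1 x := by
      rw [hV.isClosed_compl.closure_eq]
      by_cases hx : x ∈ V <;> simp [hx]
    rw [← h3]
    exact h2
  have hsum : ∀ γ : Config X, Tendsto (fun n => vagueSum (φ n) γ) atTop
      (𝓝 ((γ.1 ∩ V).ncard : ℝ)) := by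
    intro γ
    classical
    set F := (γ.2.2 _ hVc).toFinset with hF
    have h1 : ∀ n, vagueSum (φ n) γ = ∑ x ∈ F, φ n x := by
      intro n
      rw [vagueSum_eq_tsum_indicator, tsum_eq_sum (s := F)]
      · refine Finset.sum_congr rfl fun x hx => ?_
        rw [indicator_of_mem]
        exact ((Finite.mem_toFinset _).1 hx).1
      · intro x hx
        by_contra hne
        have := support_subset_inter_tsupport (φ n) γ hne
        exact hx ((Finite.mem_toFinset _).2 ⟨this.1, hsupp n this.2⟩)
    have h2 : ((γ.1 ∩ V).ncard : ℝ) = ∑ x ∈ F, V.indicator 1 x := by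
      have : γ.1 ∩ V = ↑(F.filter (· ∈ V)) := by
        ext x
        simp only [hF, Finset.coe_filter, Finite.mem_toFinset, mem_inter_iff, mem_ofPred_eq]
        exact ⟨fun h => ⟨⟨h.1, subset_closure h.2⟩, h.2⟩, fun h => ⟨h.1.1, h.2⟩⟩
      rw [this, ncard_coe_finset, Finset.card_filter]
      push_cast
      exact Finset.sum_congr rfl fun x _ => by simp [indicator_apply]
    simp only [h1, h2]
    exact tendsto_finsetSum _ fun x _ => hlim x
  have hm : Measurable fun γ : Config X => ((γ.1 ∩ V).ncard : ℝ) :=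
    measurable_of_tendsto_metrizable (fun n => (continuous_vagueSum (φ n)).measurable)
      (tendsto_pi_nhds.2 hsum)
  convert hm.ennreal_ofReal using 2 with γ
  rw [ENNReal.ofReal_natCast,
    ← ((γ.2.2 _ hVc).subset (inter_subset_inter_right _ subset_closure)).cast_ncard_eq]
  simp

/-- Counting the points of `γ` in the interior of `K j` is a finite measure depending on `γ`; open
sets form a generating π-system on which measurability is known. The exhaustion then gives the count
as a supremum. -/
theorem measurable_encard_inter {A : Set X} (hA : MeasurableSet A) :
    Measurable fun γ : Config X => ((γ.1 ∩ A).encard : ℝ≥0∞) := by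
  let K := CompactExhaustion.choice X
  have hγ : ∀ γ : Config X, MeasurableSet γ.1 := fun γ => (countable_config γ).measurableSet
  have hcl : ∀ j, IsCompact (closure (interior (K j))) := fun j =>
    (K.isCompact j).of_isClosed_subset isClosed_closure
      (closure_minimal interior_subset (K.isCompact j).isClosed)
  have hK : ∀ j, Measurable fun γ : Config X => ((γ.1 ∩ (interior (K j) ∩ A)).encard : ℝ≥0∞) := by
    intro j
    let μ : Config X → Measure X := fun γ => Measure.count.restrict (γ.1 ∩ interior (K j))
    have happ : ∀ γ, ∀ B, MeasurableSet B → μ γ B = (γ.1 ∩ (interior (K j) ∩ B)).encard := by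
      intro γ B hB
      rw [Measure.restrict_apply hB, Measure.count_apply
        (hB.inter ((hγ γ).inter isOpen_interior.measurableSet)), inter_comm B, inter_assoc]
    have hfin : ∀ γ, IsFiniteMeasure (μ γ) := fun γ => by
      constructor
      rw [happ γ _ MeasurableSet.univ, inter_univ]
      exact mod_cast ((γ.2.2 _ (K.isCompact j)).subset
        (inter_subset_inter_right _ interior_subset)).encard_lt_top
    have hopen : ∀ U : Set X, IsOpen U → Measurable fun γ => μ γ U := by
      intro U hU
      simp only [happ _ _ hU.measurableSet]
      exact measurable_encard_inter_isOpen (isOpen_interior.inter hU)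
        ((hcl j).of_isClosed_subset isClosed_closure (closure_mono inter_subset_left))
    have hmeas : Measurable μ :=
      Measurable.measure_of_isPiSystem (BorelSpace.measurable_eq (α := X)) isPiSystem_isOpen
        hopen (hopen _ isOpen_univ)
    have h := (Measure.measurable_coe hA).comp hmeas
    simp only [Function.comp_def, happ _ _ hA] at h
    exact h
  have hsup : ∀ γ : Config X, ((γ.1 ∩ A).encard : ℝ≥0∞) =
      ⨆ j, ((γ.1 ∩ (interior (K j) ∩ A)).encard : ℝ≥0∞) := by
    intro γ
    have hU : ⋃ j, interior (K j) = univ := by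
      refine eq_univ_of_forall fun x => ?_
      obtain ⟨n, hn⟩ := K.exists_mem x
      exact mem_iUnion.2 ⟨n + 1, K.subset_interior_succ n hn⟩
    have h1 : γ.1 ∩ A = ⋃ j, γ.1 ∩ (interior (K j) ∩ A) := by
      rw [← inter_iUnion, ← iUnion_inter, hU, univ_inter]
    have hm : Monotone fun j => γ.1 ∩ (interior (K j) ∩ A) := fun i j hij =>
      inter_subset_inter_right _ (inter_subset_inter_left _ (interior_mono (K.subset hij)))
    have hmj : ∀ j, MeasurableSet (γ.1 ∩ (interior (K j) ∩ A)) := fun j =>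
      (hγ γ).inter (isOpen_interior.measurableSet.inter hA)
    rw [← Measure.count_apply ((hγ γ).inter hA), h1, hm.measure_iUnion]
    exact iSup_congr fun j => Measure.count_apply (hmj j)
  simp only [hsup]
  exact Measurable.iSup hK

/-- Equality with `γ` is a countable condition on counts: no point off `γ`, and each of the
countably many points of `γ` is present. -/
theorem measurableSet_singleton_config (γ : Config X) : MeasurableSet {γ} := by
  have hm : MeasurableSet γ.1 := (countable_config γ).measurableSet
  have h : {γ} = {γ' : Config X | ((γ'.1 ∩ γ.1ᶜ).encard : ℝ≥0∞) = 0} ∩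
      ⋂ x ∈ γ.1, {γ' : Config X | ((γ'.1 ∩ {x}).encard : ℝ≥0∞) = 0}ᶜ := by
    ext γ'
    simp only [mem_singleton_iff, mem_inter_iff, mem_ofPred_eq, mem_iInter, mem_compl_iff,
      ENat.toENNReal_eq_zero, encard_eq_zero, inter_singleton_eq_empty, not_not]
    refine ⟨fun h => h ▸ ⟨inter_compl_self _, fun _ hx => hx⟩, fun h => Subtype.ext ?_⟩
    exact Subset.antisymm (disjoint_compl_right_iff_subset.1 (disjoint_iff_inter_eq_empty.2 h.1)) h.2
  rw [h]
  exact (measurable_encard_inter hm.compl (measurableSet_singleton 0)).inter <|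
    MeasurableSet.biInter (countable_config γ) fun x _ =>
      (measurable_encard_inter (measurableSet_singleton x) (measurableSet_singleton 0)).compl

end Counting

/-! ### Sequences of points and their configurations -/

section Sequences

theorem finite_range_inter_iff {X : Type u} {y : ℕ → X} (hy : Function.Injective y) (K : Set X) :
    (range y ∩ K).Finite ↔ (y ⁻¹' K).Finite := by
  rw [inter_comm, ← image_preimage_eq_inter_range]
  exact finite_image_iff hy.injOn

variable {X : Type u} [MetricSpace X] [LocallyCompactSpace X] [SecondCountableTopology X]
  [MeasurableSpace X] [BorelSpace X]

theorem measurableSet_setOf_injective : MeasurableSet {y : ℕ → X | Function.Injective y} := by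
  have h : {y : ℕ → X | Function.Injective y} = ⋂ (i : ℕ) (j : ℕ) (_ : i ≠ j), {y | y i = y j}ᶜ := by
    ext y
    simp only [Function.Injective, mem_ofPred_eq, mem_iInter, mem_compl_iff]
    exact ⟨fun h i j hij e => hij (h e), fun h i j e => by_contra fun hij => h i j hij e⟩
  rw [h]
  exact MeasurableSet.iInter fun i => MeasurableSet.iInter fun j => MeasurableSet.iInter fun _ =>
    (measurableSet_eq_fun (measurable_pi_apply i) (measurable_pi_apply j)).compl

/-- For an injective sequence, having no accumulation points means eventually leaving each set of a
countable compact exhaustion. -/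
theorem measurableSet_goodSeq : MeasurableSet (goodSeq X) := by
  let K := CompactExhaustion.choice X
  have h : goodSeq X = {y | Function.Injective y} ∩
      ⋂ j : ℕ, ⋃ N : ℕ, ⋂ (n : ℕ) (_ : N ≤ n), {y | y n ∈ K j}ᶜ := by
    ext y
    simp only [goodSeq, mem_ofPred_eq, mem_inter_iff, mem_iInter, mem_iUnion, mem_compl_iff]
    refine and_congr_right fun hy => ⟨fun h j => ?_, fun h L hL => ?_⟩
    · have := (finite_range_inter_iff hy _).1 (h _ (K.isCompact j))
      obtain ⟨N, hN⟩ := this.bddAbove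
      exact ⟨N + 1, fun n hn hyn => absurd (hN hyn) (by omega)⟩
    · obtain ⟨j, hj⟩ := K.exists_superset_of_isCompact hL
      obtain ⟨N, hN⟩ := h j
      rw [finite_range_inter_iff hy]
      refine (finite_lt_nat N).subset fun n hn => ?_
      by_contra hlt
      exact hN n (not_lt.1 hlt) (hj hn)
  rw [h]
  exact measurableSet_setOf_injective.inter <| MeasurableSet.iInter fun j =>
    MeasurableSet.iUnion fun N => MeasurableSet.iInter fun n => MeasurableSet.iInter fun _ =>
      ((measurable_pi_apply n) (K.isCompact j).measurableSet).compl

theorem measurable_toConfig : Measurable (toConfig (X := X)) := by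
  refine measurable_config_iff.2 fun φ => ?_
  have hnum : ∀ y : goodSeq X, IsNumeration (toConfig y) y.1 := fun y => ⟨y.2.1, rfl⟩
  simp only [fun y => vagueSum_eq_tsum_of_isNumeration (hnum y) φ]
  have hsummable : ∀ y : goodSeq X, Summable fun n => φ (y.1 n) := by
    intro y
    refine summable_of_hasFiniteSupport (((finite_range_inter_iff y.2.1 _).1
      (y.2.2 _ φ.hasCompactSupport)).subset fun n hn => subset_tsupport _ hn)
  refine measurable_of_tendsto_metrizable (f := fun N (y : goodSeq X) =>
    ∑ n ∈ Finset.range N, φ (y.1 n)) (fun N => ?_) (tendsto_pi_nhds.2 fun y =>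
      (hsummable y).hasSum.tendsto_sum_nat)
  exact Finset.measurable_fun_sum _ fun n _ =>
    φ.continuous.measurable.comp ((measurable_pi_apply n).comp measurable_subtype_coe)

end Sequences

/-! ### Consequences of the doubling condition -/

section Growth

variable {X : Type u} [MetricSpace X] [MeasurableSpace X]

/-- Bounds for `r ↦ vol(B(x₀, r))^α` that follow from the doubling condition. -/
structure GrowthBounds (vol : Measure X) (x₀ : X) (α : ℝ) (m : ℕ) : Prop where
  finite : ∀ r : ℕ, vol (Metric.closedBall x₀ r) ^ α < ∞
  double : ∃ L : ℕ, ∀ r : ℕ, 1 ≤ r →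
    vol (Metric.closedBall x₀ ((2 * r : ℕ) : ℝ)) ^ α ≤ L * vol (Metric.closedBall x₀ r) ^ α
  lower : ∀ F : ℕ, ∃ K : ℕ, ∀ r : ℕ, 1 ≤ r → (F : ℝ≥0∞) ≤ K * vol (Metric.closedBall x₀ r) ^ α
  upper : ∃ A : ℝ≥0, ∀ r : ℕ, 1 ≤ r →
    vol (Metric.closedBall x₀ r) ^ α ≤ A * ENNReal.ofReal ((r : ℝ) ^ (α * m))

/-- Large `β` spreads finiteness from one ball to all; `β = 2` gives `double`, and the unit ball
with `β = r` gives `upper`. Positivity of the volume of the unit ball gives `lower`, which later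
absorbs finitely many exceptional particles. -/
theorem growthBounds_of_doubling [BorelSpace X] {vol : Measure X} {x₀ : X} {m : ℕ} {C α : ℝ}
    (hC : 0 < C) (hα : 1 ≤ α) (hvol : vol univ = ∞)
    (hfin : ∃ r : ℝ, 0 < r ∧ vol (Metric.closedBall x₀ r) < ∞)
    (hd : ∀ r β : ℝ, 0 < r → 1 ≤ β → vol (Metric.closedBall x₀ (β * r)) ≤
      ENNReal.ofReal (C * β ^ m) * vol (Metric.closedBall x₀ r)) :
    GrowthBounds vol x₀ α m := by
  have hα0 : 0 ≤ α := by linarith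
  have hα1 : 0 < α := by linarith
  have hmono : ∀ r s : ℝ, r ≤ s → vol (Metric.closedBall x₀ r) ≤ vol (Metric.closedBall x₀ s) :=
    fun r s h => measure_mono (Metric.closedBall_subset_closedBall h)
  have hlt : ∀ r : ℝ, vol (Metric.closedBall x₀ r) < ∞ := by
    obtain ⟨r₀, hr₀, h⟩ := hfin
    intro r
    have h1 : (1 : ℝ) ≤ max 1 (r / r₀) := le_max_left _ _
    refine ((hmono r (max 1 (r / r₀) * r₀) ?_).trans (hd r₀ _ hr₀ h1)).trans_lt
      (ENNReal.mul_lt_top ENNReal.ofReal_lt_top h)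
    calc r = r / r₀ * r₀ := (div_mul_cancel₀ _ hr₀.ne').symm
      _ ≤ _ := mul_le_mul_of_nonneg_right (le_max_right _ _) hr₀.le
  have hfinite : ∀ r : ℝ, vol (Metric.closedBall x₀ r) ^ α < ∞ := fun r =>
    ENNReal.rpow_lt_top_of_nonneg hα0 (hlt r).ne
  -- If the unit ball were null, doubling would make every ball null, against infinite total volume.
  have hpos : 0 < vol (Metric.closedBall x₀ 1) := by
    rw [pos_iff_ne_zero]
    intro h0
    have hz : ∀ n : ℕ, vol (Metric.closedBall x₀ n) = 0 := by
      intro n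
      have := hd 1 (max 1 n) one_pos (le_max_left _ _)
      rw [h0, mul_zero, mul_one] at this
      exact le_antisymm ((hmono _ _ (le_max_right _ _)).trans this) (zero_le)
    have : vol univ = 0 := by
      rw [← Metric.iUnion_closedBall_nat x₀]
      exact measure_iUnion_null hz
    simp [hvol] at this
  have hlow : ∀ r : ℕ, 1 ≤ r →
      vol (Metric.closedBall x₀ 1) ^ α ≤ vol (Metric.closedBall x₀ r) ^ α := fun r hr =>
    ENNReal.rpow_le_rpow (hmono _ _ (by exact_mod_cast hr)) hα0
  have hpos' : vol (Metric.closedBall x₀ 1) ^ α ≠ 0 := (ENNReal.rpow_pos hpos (hlt 1).ne).ne'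
  refine ⟨fun r => hfinite r, ?_, fun F => ?_, ?_⟩
  · obtain ⟨L, hL⟩ := ENNReal.exists_nat_gt
      (ENNReal.rpow_lt_top_of_nonneg hα0 (ENNReal.ofReal_ne_top (r := C * 2 ^ m))).ne
    refine ⟨L, fun r hr => ?_⟩
    have h := hd r 2 (by exact_mod_cast hr) one_le_two
    push_cast
    calc _ ≤ (ENNReal.ofReal (C * 2 ^ m) * vol (Metric.closedBall x₀ r)) ^ α :=
          ENNReal.rpow_le_rpow h hα0
      _ = ENNReal.ofReal (C * 2 ^ m) ^ α * vol (Metric.closedBall x₀ r) ^ α :=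
          ENNReal.mul_rpow_of_nonneg _ _ hα0
      _ ≤ _ := mul_le_mul_left hL.le _
  · obtain ⟨K, hK⟩ := ENNReal.exists_nat_gt
      (ENNReal.div_lt_top (ENNReal.natCast_ne_top F) hpos').ne
    refine ⟨K, fun r hr => ?_⟩
    calc (F : ℝ≥0∞) = F / vol (Metric.closedBall x₀ 1) ^ α * vol (Metric.closedBall x₀ 1) ^ α :=
          (ENNReal.div_mul_cancel hpos' (hfinite 1).ne).symm
      _ ≤ _ := mul_le_mul' hK.le (hlow r hr)
  · have hne : (ENNReal.ofReal C * vol (Metric.closedBall x₀ 1)) ^ α ≠ ∞ :=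
      ENNReal.rpow_ne_top_of_nonneg hα0 (ENNReal.mul_ne_top ENNReal.ofReal_ne_top (hlt 1).ne)
    refine ⟨((ENNReal.ofReal C * vol (Metric.closedBall x₀ 1)) ^ α).toNNReal, fun r hr => ?_⟩
    rw [ENNReal.coe_toNNReal hne]
    have hr' : (1 : ℝ) ≤ r := by exact_mod_cast hr
    have h := hd 1 r one_pos hr'
    rw [mul_one, ENNReal.ofReal_mul hC.le] at h
    calc _ ≤ (ENNReal.ofReal C * ENNReal.ofReal ((r : ℝ) ^ m) * vol (Metric.closedBall x₀ 1)) ^ α :=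
          ENNReal.rpow_le_rpow h hα0
      _ = (ENNReal.ofReal C * vol (Metric.closedBall x₀ 1) * ENNReal.ofReal ((r : ℝ) ^ m)) ^ α := by
          ring_nf
      _ = _ := by
          rw [ENNReal.mul_rpow_of_nonneg _ _ hα0, ENNReal.ofReal_rpow_of_nonneg (by positivity) hα0,
            ← Real.rpow_natCast, ← Real.rpow_mul (by positivity), mul_comm α]

end Growth

/-! ### Increasing enumeration of discrete sets of reals -/

section Enumeration

/-- With finite initial segments, `S` is a locally finite linear order with a least and no greatest
element, hence order isomorphic to `ℕ`. -/
theorem exists_strictMono_range_eq {S : Set ℝ} (hS : S.Infinite) (hf : ∀ c, (S ∩ Iic c).Finite) :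
    ∃ x : ℕ → ℝ, StrictMono x ∧ range x = S := by
  have hfin : ∀ c : S, (Iic c).Finite := fun c => by
    refine Finite.of_finite_image ((hf c).subset ?_) Subtype.val_injective.injOn
    rintro _ ⟨y, hy, rfl⟩
    exact ⟨y.2, hy⟩
  obtain ⟨c₀⟩ : Nonempty S := hS.nonempty.to_subtype
  have : Infinite S := hS.to_subtype
  let : LocallyFiniteOrder S := LocallyFiniteOrder.ofFiniteIcc fun a b =>
    (hfin b).subset Icc_subset_Iic_self
  let := LinearLocallyFiniteOrder.succOrder S
  let := LinearLocallyFiniteOrder.predOrder S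
  have : NoMaxOrder S := ⟨fun a => by
    by_contra! h
    exact infinite_univ ((hfin a).subset fun b _ => h b)⟩
  obtain ⟨b, hb⟩ : ∃ b : S, ∀ a, b ≤ a := by
    obtain ⟨b, -, hb⟩ := exists_min_image (Iic c₀) id (hfin c₀) nonempty_Iic
    exact ⟨b, fun a => (le_total a c₀).elim (hb a) fun h => (hb c₀ (mem_Iic.2 le_rfl)).trans h⟩
  let : OrderBot S := { bot := b, bot_le := hb }
  let e := orderIsoNatOfLinearSuccPredArch (ι := S)
  refine ⟨fun n => e.symm n, fun i j h => e.symm.strictMono h, ?_⟩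
  rw [range_comp' Subtype.val, e.symm.surjective.range_eq, image_univ, Subtype.range_coe]

/-- This expresses the `n`-th point through counts, which are known to be measurable functions of
the configuration. -/
theorem le_iff_card_le {x : ℕ → ℝ} (hx : StrictMono x) (c : ℝ) (n : ℕ) : x n ≤ c ↔ ((n + 1 : ℕ) : ℕ∞) ≤ (range x ∩ Iic c).encard := by
  constructor
  · intro h
    calc ((n + 1 : ℕ) : ℕ∞) = (x '' Iic n).encard := by
          rw [hx.injective.encard_image, ← Finset.coe_Iic, encard_coe_eq_coe_finsetCard, Nat.card_Iic]
      _ ≤ _ := encard_le_encard (by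
          rintro _ ⟨k, hk, rfl⟩
          exact ⟨mem_range_self _, (hx.monotone hk).trans h⟩)
  · intro h
    by_contra hc
    have : range x ∩ Iic c ⊆ x '' Iio n := by
      rintro _ ⟨⟨k, rfl⟩, hk⟩
      exact ⟨k, hx.lt_iff_lt.1 (lt_of_le_of_lt hk (not_le.1 hc)), rfl⟩
    have h2 := h.trans (encard_le_encard this)
    rw [hx.injective.encard_image, ← Finset.coe_Iio, encard_coe_eq_coe_finsetCard,
      Nat.card_Iio] at h2
    have := Nat.cast_le.1 h2
    omega

end Enumeration

/-! ### Configurations in `Θ_α` and their numerations -/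

section Theta

variable {X : Type u} [MetricSpace X] [MeasurableSpace X]

/-- The sequences of pairwise distinct points that satisfy the growth bound of `Θ_α`. -/
def thetaSeq (vol : Measure X) (x₀ : X) (α : ℝ) : Set (ℕ → X) :=
  {y | Function.Injective y ∧ ∃ K : ℕ, ∀ r : ℕ, 1 ≤ r →
    ({n | y n ∈ Metric.closedBall x₀ r}.encard : ℝ≥0∞) ≤ K * vol (Metric.closedBall x₀ r) ^ α}

variable {vol : Measure X} {x₀ : X} {α : ℝ} {m : ℕ}

/-- The sequences which enumerate a configuration that belongs to `A`. -/
def numerations (A : Set (Theta vol x₀ α)) : Set (ℕ → X) :=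
  {y | ∃ γ ∈ A, IsNumeration γ.1 y}

theorem IsNumeration.eq {γ γ' : Config X} {y : ℕ → X} (h : IsNumeration γ y)
    (h' : IsNumeration γ' y) : γ = γ' :=
  Subtype.ext (h.2.symm.trans h'.2)

theorem IsNumeration.mem_numerations_iff {γ : Theta vol x₀ α} {y : ℕ → X}
    (h : IsNumeration γ.1 y) {A : Set (Theta vol x₀ α)} : y ∈ numerations A ↔ γ ∈ A := by
  refine ⟨fun ⟨γ', hγ', h'⟩ => ?_, fun hA => ⟨γ, hA, h⟩⟩
  rwa [Subtype.ext (h.eq h')]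

theorem IsNumeration.comp_equiv {γ : Config X} {y : ℕ → X} (h : IsNumeration γ y) (σ : ℕ ≃ ℕ) :
    IsNumeration γ (y ∘ σ) :=
  ⟨h.1.comp σ.injective, (EquivLike.range_comp y σ).trans h.2⟩

/-- This permutation invariance is the reason why laws of configurations do not depend on the
numeration. -/
theorem comp_equiv_mem_numerations_iff {A : Set (Theta vol x₀ α)} (y : ℕ → X) (σ : ℕ ≃ ℕ) :
    y ∘ σ ∈ numerations A ↔ y ∈ numerations A := by
  refine ⟨fun ⟨γ, hγ, h⟩ => ⟨γ, hγ, ?_⟩, fun ⟨γ, hγ, h⟩ => ⟨γ, hγ, h.comp_equiv σ⟩⟩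
  simpa [Function.comp_assoc] using h.comp_equiv σ.symm

theorem IsNumeration.exists_equiv {γ : Config X} {x y : ℕ → X} (hx : IsNumeration γ x)
    (hy : IsNumeration γ y) : ∃ σ : ℕ ≃ ℕ, y = x ∘ σ := by
  let e := Equiv.ofInjective x hx.1
  let e' := Equiv.ofInjective y hy.1
  refine ⟨e'.trans ((Equiv.setCongr (hy.2.trans hx.2.symm)).trans e.symm), funext fun n => ?_⟩
  have h := Equiv.apply_ofInjective_symm hx.1
    (Equiv.setCongr (hy.2.trans hx.2.symm) (e' n))
  exact h.symm

theorem IsNumeration.encard_inter {γ : Config X} {y : ℕ → X} (h : IsNumeration γ y) (B : Set X) :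
    (γ.1 ∩ B).encard = {n | y n ∈ B}.encard := by
  rw [← h.2, inter_comm, ← image_preimage_eq_inter_range, h.1.encard_image]
  rfl

theorem IsNumeration.mem_thetaSeq {γ : Theta vol x₀ α} {y : ℕ → X} (h : IsNumeration γ.1 y) :
    y ∈ thetaSeq vol x₀ α := by
  obtain ⟨K, hK⟩ := γ.2
  exact ⟨h.1, K, fun r hr => h.encard_inter _ ▸ hK r hr⟩

theorem finite_of_encard_le {ι : Type*} {s : Set ι} {c : ℝ≥0∞} (h : (s.encard : ℝ≥0∞) ≤ c)
    (hc : c < ∞) : s.Finite := by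
  rw [← encard_lt_top_iff]
  exact_mod_cast h.trans_lt hc

theorem exists_nat_closedBall_superset (x₀ : X) {K : Set X} (hK : IsCompact K) :
    ∃ r : ℕ, 1 ≤ r ∧ K ⊆ Metric.closedBall x₀ r := by
  obtain ⟨R, hR⟩ := hK.isBounded.subset_closedBall x₀
  obtain ⟨r, hr⟩ := exists_nat_ge (max R 1)
  exact ⟨r, by exact_mod_cast (le_max_right _ _).trans hr,
    hR.trans (Metric.closedBall_subset_closedBall ((le_max_left _ _).trans hr))⟩

theorem finite_setOf_mem_isCompact (hG : GrowthBounds vol x₀ α m) {y : ℕ → X}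
    (hy : ∃ K : ℕ, ∀ r : ℕ, 1 ≤ r → ({n | y n ∈ Metric.closedBall x₀ r}.encard : ℝ≥0∞) ≤
      K * vol (Metric.closedBall x₀ r) ^ α) {K : Set X} (hK : IsCompact K) :
    {n | y n ∈ K}.Finite := by
  obtain ⟨N, hN⟩ := hy
  obtain ⟨r, hr, hKr⟩ := exists_nat_closedBall_superset x₀ hK
  exact (finite_of_encard_le (hN r hr)
    (ENNReal.mul_lt_top (ENNReal.natCast_lt_top N) (hG.finite r))).subset fun n hn => hKr hn

theorem exists_isNumeration_of_mem_thetaSeq (hG : GrowthBounds vol x₀ α m) {y : ℕ → X}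
    (hy : y ∈ thetaSeq vol x₀ α) : ∃ γ : Theta vol x₀ α, IsNumeration γ.1 y := by
  have hc : ∀ K : Set X, IsCompact K → (range y ∩ K).Finite := fun K hK =>
    (finite_range_inter_iff hy.1 K).2 (finite_setOf_mem_isCompact hG hy.2 hK)
  have hnum : IsNumeration (⟨range y, infinite_range_of_injective hy.1, hc⟩ : Config X) y :=
    ⟨hy.1, rfl⟩
  obtain ⟨K, hK⟩ := hy.2
  exact ⟨⟨_, K, fun r hr => (hnum.encard_inter _).symm ▸ hK r hr⟩, hnum⟩

theorem numerations_univ (hG : GrowthBounds vol x₀ α m) :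
    numerations (univ : Set (Theta vol x₀ α)) = thetaSeq vol x₀ α := by
  ext y
  refine ⟨fun ⟨γ, _, h⟩ => h.mem_thetaSeq, fun hy => ?_⟩
  obtain ⟨γ, hγ⟩ := exists_isNumeration_of_mem_thetaSeq hG hy
  exact ⟨γ, mem_univ _, hγ⟩

theorem finite_inter_closedBall (hG : GrowthBounds vol x₀ α m) (γ : Theta vol x₀ α) (r : ℕ) :
    (γ.1.1 ∩ Metric.closedBall x₀ r).Finite := by
  obtain ⟨K, hK⟩ := γ.2
  -- The bound of `Θ_α` is only available for radii at least 1, while `r` may be 0.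
  have h := finite_of_encard_le (hK (r + 1) (by omega))
    (ENNReal.mul_lt_top (ENNReal.natCast_lt_top K) (hG.finite (r + 1)))
  refine h.subset (inter_subset_inter_right _ (Metric.closedBall_subset_closedBall ?_))
  push_cast
  linarith

end Theta

/-! ### Measurability of `Θ_α` and a measurable numeration -/

section ThetaMeasurable

variable {X : Type u} [MetricSpace X] [LocallyCompactSpace X] [SecondCountableTopology X]
  [MeasurableSpace X] [BorelSpace X] {vol : Measure X} {x₀ : X} {α : ℝ} {m : ℕ}

theorem measurable_encard_setOf_mem {B : Set X} (hB : MeasurableSet B) :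
    Measurable fun y : ℕ → X => ({n | y n ∈ B}.encard : ℝ≥0∞) := by
  have h : ∀ y : ℕ → X, ({n | y n ∈ B}.encard : ℝ≥0∞) = ∑' n, B.indicator 1 (y n) := by
    intro y
    rw [← ENNReal.tsum_set_one, tsum_subtype {n | y n ∈ B} (fun _ => (1 : ℝ≥0∞))]
    rfl
  simp only [h]
  exact Measurable.tsum fun n =>
    (measurable_one.indicator hB).comp (measurable_pi_apply n)

theorem measurableSet_thetaSeq : MeasurableSet (thetaSeq vol x₀ α) := by
  have h : thetaSeq vol x₀ α = {y | Function.Injective y} ∩ ⋃ K : ℕ, ⋂ (r : ℕ) (_ : 1 ≤ r),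
      {y | ({n | y n ∈ Metric.closedBall x₀ r}.encard : ℝ≥0∞) ≤
        K * vol (Metric.closedBall x₀ r) ^ α} := by
    ext y
    simp [thetaSeq]
  rw [h]
  exact measurableSet_setOf_injective.inter <| MeasurableSet.iUnion fun K =>
    MeasurableSet.iInter fun r => MeasurableSet.iInter fun _ =>
      measurableSet_le (measurable_encard_setOf_mem Metric.isClosed_closedBall.measurableSet)
        measurable_const

theorem thetaSeq_subset_goodSeq (hG : GrowthBounds vol x₀ α m) :
    thetaSeq vol x₀ α ⊆ goodSeq X := fun _ hy =>
  ⟨hy.1, fun _ hK => (finite_range_inter_iff hy.1 _).2 (finite_setOf_mem_isCompact hG hy.2 hK)⟩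

theorem toConfig_mem_theta (hG : GrowthBounds vol x₀ α m) (y : thetaSeq vol x₀ α) :
    toConfig ⟨y.1, thetaSeq_subset_goodSeq hG y.2⟩ ∈ Theta vol x₀ α := by
  obtain ⟨γ, hγ⟩ := exists_isNumeration_of_mem_thetaSeq hG y.2
  have h : toConfig ⟨y.1, thetaSeq_subset_goodSeq hG y.2⟩ = γ.1 := Subtype.ext hγ.2
  exact h ▸ γ.2

/-- The element of `Θ_α` formed by the members of a sequence. -/
def toTheta (hG : GrowthBounds vol x₀ α m) (y : thetaSeq vol x₀ α) : Theta vol x₀ α :=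
  ⟨_, toConfig_mem_theta hG y⟩

theorem isNumeration_toTheta (hG : GrowthBounds vol x₀ α m) (y : thetaSeq vol x₀ α) :
    IsNumeration (toTheta hG y).1 y.1 :=
  ⟨y.2.1, rfl⟩

theorem measurable_toTheta (hG : GrowthBounds vol x₀ α m) : Measurable (toTheta hG) := by
  refine Measurable.subtype_mk (measurable_toConfig.comp ?_)
  exact Measurable.subtype_mk measurable_subtype_coe

theorem numerations_eq_image (hG : GrowthBounds vol x₀ α m) (A : Set (Theta vol x₀ α)) :
    numerations A = Subtype.val '' (toTheta hG ⁻¹' A) := by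
  ext y
  constructor
  · rintro ⟨γ, hγ, h⟩
    exact ⟨⟨y, h.mem_thetaSeq⟩,
      ((isNumeration_toTheta hG ⟨y, h.mem_thetaSeq⟩).mem_numerations_iff).1 ⟨γ, hγ, h⟩, rfl⟩
  · rintro ⟨z, hz, rfl⟩
    exact ⟨_, hz, isNumeration_toTheta hG z⟩

theorem measurableSet_numerations (hG : GrowthBounds vol x₀ α m) {A : Set (Theta vol x₀ α)}
    (hA : MeasurableSet A) : MeasurableSet (numerations A) := by
  rw [numerations_eq_image hG]
  exact measurableSet_thetaSeq.subtype_image (measurable_toTheta hG hA)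

/-- The integer part records the distance and the fractional part is a Borel injection into `(0,
1)`. Sorting by `f` is thus sorting by distance up to rounding, with ties broken measurably. -/
theorem exists_injective_measurable_floor [CompleteSpace X] (x₀ : X) :
    ∃ f : X → ℝ, MeasurableEmbedding f ∧ ∀ x, ⌊f x⌋ = ⌊dist x x₀⌋ := by
  have : StandardBorelSpace X := inferInstance
  let f : X → ℝ := fun x => (⌊dist x x₀⌋ : ℝ) + Real.sigmoid (embeddingReal X x)
  have hfl : ∀ x, ⌊f x⌋ = ⌊dist x x₀⌋ := fun x => by
    rw [Int.floor_eq_iff]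
    exact ⟨le_add_of_nonneg_right (Real.sigmoid_pos _).le,
      add_lt_add_right (Real.sigmoid_lt_one _) _⟩
  refine ⟨f, Measurable.measurableEmbedding ?_ ?_, hfl⟩
  · refine Measurable.add ?_ (continuous_sigmoid.measurable.comp
      (measurableEmbedding_embeddingReal X).measurable)
    exact (measurable_from_top.comp Int.measurable_floor).comp
      (continuous_id.dist continuous_const).measurable
  · intro x y h
    have h1 : ⌊dist x x₀⌋ = ⌊dist y x₀⌋ := by rw [← hfl, ← hfl, h]
    have h2 : (⌊dist x x₀⌋ : ℝ) + Real.sigmoid (embeddingReal X x) =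
      ⌊dist y x₀⌋ + Real.sigmoid (embeddingReal X y) := h
    rw [h1] at h2
    exact (measurableEmbedding_embeddingReal X).injective
      (Real.sigmoid_injective (add_left_cancel h2))

/-- There is a measurable choice of numerations that runs through the points roughly in the order
of their distances from `x₀`. -/
theorem exists_measurable_numeration [CompleteSpace X] (hG : GrowthBounds vol x₀ α m) :
    ∃ N : Theta vol x₀ α → ℕ → X, Measurable N ∧ (∀ γ, IsNumeration γ.1 (N γ)) ∧
      ∀ γ n, ∀ R : ℕ, dist (N γ n) x₀ < R →
        ((n + 1 : ℕ) : ℕ∞) ≤ (γ.1.1 ∩ Metric.closedBall x₀ R).encard := by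
  obtain ⟨f, hf, hfl⟩ := exists_injective_measurable_floor x₀
  -- As `R` is an integer, both inequalities only depend on the common integer part.
  have hlt : ∀ x, ∀ R : ℕ, f x < R ↔ dist x x₀ < R := fun x R => by
    have h1 := Int.floor_lt (z := (R : ℤ)) (a := f x)
    have h2 := Int.floor_lt (z := (R : ℤ)) (a := dist x x₀)
    rw [hfl] at h1
    exact_mod_cast h1.symm.trans h2
  have hfin : ∀ γ : Theta vol x₀ α, ∀ c, (γ.1.1 ∩ f ⁻¹' Iic c).Finite := fun γ c => by
    obtain ⟨R, hR⟩ := exists_nat_gt c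
    refine (finite_inter_closedBall hG γ R).subset (inter_subset_inter_right _ fun x hx => ?_)
    exact ((hlt x R).1 (lt_of_le_of_lt hx hR)).le
  have hex : ∀ γ : Theta vol x₀ α, ∃ y : ℕ → X, IsNumeration γ.1 y ∧ StrictMono (f ∘ y) := by
    intro γ
    obtain ⟨x, hx, hr⟩ := exists_strictMono_range_eq (S := f '' γ.1.1)
      (γ.1.2.1.image hf.injective.injOn)
      (fun c => by rw [← image_inter_preimage]; exact (hfin γ c).image _)
    have hy : ∀ n, ∃ y ∈ γ.1.1, f y = x n := fun n => by
      have : x n ∈ f '' γ.1.1 := hr ▸ mem_range_self n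
      exact this
    choose y hy hfy using hy
    have hfy' : f ∘ y = x := funext hfy
    refine ⟨y, ⟨Function.Injective.of_comp (f := f) (hfy' ▸ hx.injective), ?_⟩, hfy' ▸ hx⟩
    refine Subset.antisymm (range_subset_iff.2 hy) fun z hz => ?_
    have : f z ∈ range x := hr ▸ mem_image_of_mem f hz
    obtain ⟨n, hn⟩ := this
    exact ⟨n, hf.injective ((hfy n).trans hn)⟩
  choose N hN hmono using hex
  have key : ∀ γ n c, f (N γ n) ≤ c ↔
      ((n + 1 : ℕ) : ℕ∞) ≤ (γ.1.1 ∩ f ⁻¹' Iic c).encard := by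
    intro γ n c
    have hr : range (f ∘ N γ) ∩ Iic c = f '' (γ.1.1 ∩ f ⁻¹' Iic c) := by
      rw [image_inter_preimage, range_comp, (hN γ).2]
    have h := le_iff_card_le (hmono γ) c n
    rwa [hr, hf.injective.encard_image] at h
  refine ⟨N, measurable_pi_iff.2 fun n => ?_, hN, fun γ n R hR => ?_⟩
  -- Since `f` is a measurable embedding, it is enough to treat `f (N γ n)`, whose sublevel sets are
  -- conditions on counts by `key`.
  · rw [← hf.measurable_comp_iff]
    refine measurable_of_Iic fun c => ?_
    have h : (f ∘ fun γ => N γ n) ⁻¹' Iic c =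
        {γ | ((n + 1 : ℕ) : ℝ≥0∞) ≤ ((γ.1.1 ∩ f ⁻¹' Iic c).encard : ℝ≥0∞)} := by
      ext γ
      refine (key γ n c).trans ?_
      rw [mem_ofPred_eq, ← ENat.toENNReal_coe, ENat.toENNReal_le]
    rw [h]
    exact measurableSet_le measurable_const
      ((measurable_encard_inter (hf.measurable measurableSet_Iic)).comp measurable_subtype_coe)
  · refine ((key γ n (f (N γ n))).1 le_rfl).trans (encard_le_encard
      (inter_subset_inter_right _ fun x hx => ?_))
    exact ((hlt x R).1 (lt_of_le_of_lt hx ((hlt _ R).2 hR))).le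

end ThetaMeasurable

/-! ### Measures on path spaces and product measures via cylinders -/

section Cylinders

variable {ι : Type*} {S : ι → Type*} [∀ i, MeasurableSpace (S i)]

theorem generateFrom_preimage_squareCylinders (W : (∀ i, S i) → Prop) :
    (inferInstance : MeasurableSpace {w // W w}) = MeasurableSpace.generateFrom
      (preimage Subtype.val '' squareCylinders fun i => {s : Set (S i) | MeasurableSet s}) := by
  rw [← MeasurableSpace.comap_generateFrom, generateFrom_squareCylinders]
  rfl

theorem isPiSystem_preimage_squareCylinders (W : (∀ i, S i) → Prop) :
    IsPiSystem (preimage (Subtype.val : {w // W w} → ∀ i, S i) ''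
      squareCylinders fun i => {s : Set (S i) | MeasurableSet s}) := by
  have h := (isPiSystem_squareCylinders (C := fun i => {s : Set (S i) | MeasurableSet s})
    (fun i => MeasurableSpace.isPiSystem_measurableSet) fun i => MeasurableSet.univ).comap
      (Subtype.val : {w // W w} → ∀ i, S i)
  exact h

theorem measure_subtype_pi_ext {W : (∀ i, S i) → Prop} {μ ν : Measure {w // W w}} [IsProbabilityMeasure μ]
    [IsProbabilityMeasure ν]
    (h : ∀ (I : Finset ι) (A : ∀ i, Set (S i)), (∀ i, MeasurableSet (A i)) →
      μ {w | ∀ i ∈ I, w.1 i ∈ A i} = ν {w | ∀ i ∈ I, w.1 i ∈ A i}) : μ = ν := by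
  refine ext_of_generate_finite _ (generateFrom_preimage_squareCylinders W)
    (isPiSystem_preimage_squareCylinders W) ?_ (by simp)
  rintro _ ⟨_, ⟨I, A, hA, rfl⟩, rfl⟩
  exact h I A fun i => hA i (mem_univ i)

theorem measurable_measure_subtype_pi {β : Type*} [MeasurableSpace β] {W : (∀ i, S i) → Prop}
    {μ : β → Measure {w // W w}} [∀ b, IsProbabilityMeasure (μ b)]
    (h : ∀ (I : Finset ι) (A : ∀ i, Set (S i)), (∀ i, MeasurableSet (A i)) →
      Measurable fun b => μ b {w | ∀ i ∈ I, w.1 i ∈ A i}) : Measurable μ := by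
  refine Measurable.measure_of_isPiSystem_of_isProbabilityMeasure
    (generateFrom_preimage_squareCylinders W) (isPiSystem_preimage_squareCylinders W) ?_
  rintro _ ⟨_, ⟨I, A, hA, rfl⟩, rfl⟩
  exact h I A fun i => hA i (mem_univ i)

theorem measurable_infinitePi {T β : Type*} [MeasurableSpace T] [MeasurableSpace β]
    {Q : β → Measure T} [∀ b, IsProbabilityMeasure (Q b)] (hQ : Measurable Q) :
    Measurable fun x : ι → β => Measure.infinitePi fun i => Q (x i) := by
  refine Measurable.measure_of_isPiSystem_of_isProbabilityMeasure
    generateFrom_squareCylinders.symm (isPiSystem_squareCylinders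
      (fun i => MeasurableSpace.isPiSystem_measurableSet) fun i => MeasurableSet.univ) ?_
  rintro _ ⟨I, A, hA, rfl⟩
  have hA' : ∀ i, MeasurableSet (A i) := fun i => hA i (mem_univ i)
  simp only [Measure.infinitePi_pi _ fun i _ => hA' i]
  exact Finset.measurable_fun_prod _ fun i _ =>
    (Measure.measurable_coe (hA' i)).comp (hQ.comp (measurable_pi_apply i))

end Cylinders

/-! ### The Markov property in integrated form -/

section MarkovProperty

variable {Ω S : Type u} [MeasurableSpace S] {mΩ : MeasurableSpace Ω}
  {ℱ : Filtration ℝ≥0 mΩ} {Z : ℝ≥0 → Ω → S} {p : ℝ≥0 → Kernel S S} {μ : Measure Ω}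
  [IsFiniteMeasure μ] [∀ t, IsMarkovKernel (p t)]

/-- Integrating the conditional probability over `B` gives a form of the Markov property that passes
to products and images of measures; `hasMarkovProperty_of_measure_inter` leads back. -/
theorem HasMarkovProperty.measure_inter (h : HasMarkovProperty ℱ Z p μ)
    (hZ : ∀ t, Measurable (Z t)) {s : ℝ≥0} (t : ℝ≥0) {B : Set Ω} (hB : MeasurableSet[ℱ s] B)
    {A : Set S} (hA : MeasurableSet A) :
    μ (B ∩ Z (s + t) ⁻¹' A) = ∫⁻ w in B, p t (Z s w) A ∂μ := by
  have hm : Measurable fun w => p t (Z s w) A := ((p t).measurable_coe hA).comp (hZ s)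
  have hint : Integrable ((Z (s + t) ⁻¹' A).indicator fun _ => (1 : ℝ)) μ :=
    (integrable_const _).indicator (hZ _ hA)
  have h1 := setIntegral_condExp (ℱ.le s) hint hB
  have h2 : ∫ w in B, (μ⟦Z (s + t) ⁻¹' A|ℱ s⟧) w ∂μ = ∫ w in B, (p t (Z s w)).real A ∂μ :=
    setIntegral_congr_ae (ℱ.le s _ hB) ((h s t A hA).mono fun w hw _ => hw)
  rw [h2] at h1
  have h3 : ∫ w in B, (Z (s + t) ⁻¹' A).indicator (fun _ => (1 : ℝ)) w ∂μ =
      μ.real (B ∩ Z (s + t) ⁻¹' A) := by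
    rw [integral_indicator (hZ _ hA), Measure.restrict_restrict (hZ _ hA), inter_comm]
    simp
  rw [h3] at h1
  have h4 : ∫ w in B, (p t (Z s w)).real A ∂μ = (∫⁻ w in B, p t (Z s w) A ∂μ).toReal :=
    integral_toReal hm.aemeasurable (ae_of_all _ fun w => measure_lt_top _ _)
  rw [h4] at h1
  have hfin : ∫⁻ w in B, p t (Z s w) A ∂μ ≠ ∞ := by
    refine ((lintegral_mono fun w => prob_le_one).trans_lt ?_).ne
    simp
  exact ((ENNReal.toReal_eq_toReal_iff' hfin (measure_ne_top _ _)).1 h1).symm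

theorem hasMarkovProperty_of_measure_inter (hZ : ∀ t, Measurable[ℱ t] (Z t))
    (h : ∀ (s t : ℝ≥0) (B : Set Ω), MeasurableSet[ℱ s] B → ∀ A : Set S, MeasurableSet A →
      μ (B ∩ Z (s + t) ⁻¹' A) = ∫⁻ w in B, p t (Z s w) A ∂μ) : HasMarkovProperty ℱ Z p μ := by
  intro s t A hA
  have hZ' : ∀ t, Measurable (Z t) := fun t => (hZ t).mono (ℱ.le t) le_rfl
  have hm : Measurable[ℱ s] fun w => p t (Z s w) A := ((p t).measurable_coe hA).comp (hZ s)
  have hmr : StronglyMeasurable[ℱ s] fun w => (p t (Z s w)).real A :=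
    hm.ennreal_toReal.stronglyMeasurable
  have hint : Integrable ((Z (s + t) ⁻¹' A).indicator fun _ => (1 : ℝ)) μ :=
    (integrable_const _).indicator (hZ' _ hA)
  refine (ae_eq_condExp_of_forall_setIntegral_eq (ℱ.le s) hint ?_ ?_
    hmr.aestronglyMeasurable).symm
  · intro B _ _
    refine (Integrable.of_bound (C := 1) (hmr.mono (ℱ.le s)).aestronglyMeasurable
      (ae_of_all _ fun w => ?_)).integrableOn
    rw [Real.norm_of_nonneg measureReal_nonneg]
    exact measureReal_le_one
  · intro B hB _
    rw [integral_indicator (hZ' _ hA), Measure.restrict_restrict (hZ' _ hA), inter_comm]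
    have h4 : ∫ w in B, (p t (Z s w)).real A ∂μ = (∫⁻ w in B, p t (Z s w) A ∂μ).toReal :=
      integral_toReal (hm.mono (ℱ.le s) le_rfl).aemeasurable
        (ae_of_all _ fun w => measure_lt_top _ _)
    rw [h4, ← h s t B hB A hA]
    simp [Measure.real]

/-- The measures with densities `g(Z_{s+t})` and `(p_t g)(Z_s)` agree on `ℱ s`, so every `ℱ
s`-measurable `f` has the same integral under both. -/
theorem HasMarkovProperty.lintegral_mul (h : HasMarkovProperty ℱ Z p μ)
    (hZ : ∀ t, Measurable (Z t)) {s : ℝ≥0} (t : ℝ≥0) {f : Ω → ℝ≥0∞} (hf : Measurable[ℱ s] f)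
    {g : S → ℝ≥0∞} (hg : Measurable g) :
    ∫⁻ w, f w * g (Z (s + t) w) ∂μ = ∫⁻ w, f w * ∫⁻ y, g y ∂(p t (Z s w)) ∂μ := by
  have hg' : Measurable fun w => ∫⁻ y, g y ∂(p t (Z s w)) :=
    (Measurable.lintegral_kernel hg).comp (hZ s)
  have key : ∀ B, MeasurableSet[ℱ s] B →
      ∫⁻ w in B, g (Z (s + t) w) ∂μ = ∫⁻ w in B, ∫⁻ y, g y ∂(p t (Z s w)) ∂μ := by
    intro B hB
    have hm : (μ.restrict B).map (Z (s + t)) = ((μ.restrict B).map (Z s)).bind (p t) := by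
      ext A hA
      rw [Measure.map_apply (hZ _) hA, Measure.restrict_apply (hZ _ hA), inter_comm,
        h.measure_inter hZ t hB hA, Measure.bind_apply hA (p t).aemeasurable,
        lintegral_map ((p t).measurable_coe hA) (hZ s)]
    rw [← lintegral_map hg (hZ _), hm, Measure.lintegral_bind (p t).aemeasurable hg.aemeasurable,
      lintegral_map (Measurable.lintegral_kernel hg) (hZ s)]
  have htrim : (μ.withDensity fun w => g (Z (s + t) w)).trim (ℱ.le s) =
      (μ.withDensity fun w => ∫⁻ y, g y ∂(p t (Z s w))).trim (ℱ.le s) := by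
    refine @Measure.ext _ (ℱ s) _ _ fun B hB => ?_
    rw [trim_measurableSet_eq _ hB, trim_measurableSet_eq _ hB,
      withDensity_apply _ (ℱ.le s _ hB), withDensity_apply _ (ℱ.le s _ hB), key B hB]
  have hf' : Measurable f := hf.mono (ℱ.le s) le_rfl
  have h1 := lintegral_trim (μ := μ.withDensity fun w => g (Z (s + t) w)) (ℱ.le s) hf
  have h2 := lintegral_trim (μ := μ.withDensity fun w => ∫⁻ y, g y ∂(p t (Z s w))) (ℱ.le s) hf
  rw [htrim, h2, lintegral_withDensity_eq_lintegral_mul _ hg' hf',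
    lintegral_withDensity_eq_lintegral_mul _ (show Measurable fun w => g (Z (s + t) w) from hg.comp (hZ _)) hf'] at h1
  simpa [mul_comm] using h1.symm

end MarkovProperty

/-! ### Time shifts of cadlag paths -/

section Shift

variable {S : Type u} [TopologicalSpace S]

theorem tendsto_const_add_nhdsLT (s t : ℝ≥0) :
    Tendsto (fun u => s + u) (𝓝[<] t) (𝓝[<] (s + t)) :=
  tendsto_nhdsWithin_of_tendsto_nhds_of_eventually_within _
    ((continuous_const.add continuous_id).tendsto' t _ rfl |>.mono_left nhdsWithin_le_nhds)
    (eventually_mem_nhdsWithin.mono fun _ hu => add_lt_add_right hu s)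

theorem continuousWithinAt_const_add {w : ℝ≥0 → S} {s t : ℝ≥0}
    (h : ContinuousWithinAt w (Ici (s + t)) (s + t)) :
    ContinuousWithinAt (fun u => w (s + u)) (Ici t) t :=
  h.comp (continuous_const.add continuous_id).continuousWithinAt fun _ hu => add_le_add_right hu s

theorem IsCadlag.const_add {w : ℝ≥0 → S} (hw : IsCadlag w) (s : ℝ≥0) :
    IsCadlag fun t => w (s + t) := by
  refine ⟨fun t => continuousWithinAt_const_add (hw.1 _), fun t ht => ?_⟩
  obtain ⟨l, hl⟩ := hw.2 (s + t) (by positivity)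
  exact ⟨l, hl.comp (tendsto_const_add_nhdsLT s t)⟩

/-- The path `t ↦ w(s + t)`. -/
def shiftPath (s : ℝ≥0) (w : CadlagPath S) : CadlagPath S :=
  ⟨fun t => w.1 (s + t), w.2.const_add s⟩

variable [MeasurableSpace S]

theorem measurable_eval_path (t : ℝ≥0) : Measurable fun w : CadlagPath S => w.1 t :=
  (measurable_pi_apply t).comp measurable_subtype_coe

theorem measurable_shiftPath (s : ℝ≥0) : Measurable (shiftPath (S := S) s) :=
  Measurable.subtype_mk (measurable_pi_lambda _ fun t => measurable_eval_path (s + t))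

theorem measurable_eval_pathFiltration {s t : ℝ≥0} (h : s ≤ t) :
    Measurable[pathFiltration S t] fun w : CadlagPath S => w.1 s :=
  Measurable.mono (comap_measurable _)
    (le_iSup (fun r : {r : ℝ≥0 // r ≤ t} =>
      MeasurableSpace.comap (fun w : CadlagPath S => w.1 r.1) inferInstance) ⟨s, h⟩) le_rfl

end Shift

/-! ### Finite-dimensional distributions and the Markov property for the whole future -/

section Family

variable {S : Type u} [TopologicalSpace S] [MeasurableSpace S] {p : ℝ≥0 → Kernel S S}
  {P : S → Measure (CadlagPath S)}

theorem IsCadlagMarkovFamily.map_eval (hp : IsMarkovSemigroup p) (hP : IsCadlagMarkovFamily p P)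
    (t : ℝ≥0) (x : S) : (P x).map (fun w => w.1 t) = p t x := by
  have := hp.isMarkovKernel
  have := hP.isProbabilityMeasure x
  ext A hA
  have h := (hP.markov x).measure_inter (fun t => measurable_eval_path t) (s := 0) t
    MeasurableSet.univ hA
  rw [Measure.map_apply (measurable_eval_path t) hA]
  rw [univ_inter, zero_add, Measure.restrict_univ] at h
  rw [h, lintegral_congr_ae (g := fun _ => p t x A)]
  · simp
  · filter_upwards [hP.start x] with w hw
    rw [hw]

/-- Induction on the latest time: the Markov property at the last time `b` before `a` replaces `f a`
by `p_{a-b} f a`, evaluated at time `b`. The point is that `Φ` depends neither on `x` nor on `s`. -/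
theorem IsCadlagMarkovFamily.exists_lintegral_prod (hp : IsMarkovSemigroup p)
    (hP : IsCadlagMarkovFamily p P) (I : Finset ℝ≥0) :
    ∀ f : ℝ≥0 → S → ℝ≥0∞, (∀ i, Measurable (f i)) →
      ∃ Φ : S → ℝ≥0∞, Measurable Φ ∧ ∀ x s,
        ∫⁻ w, ∏ i ∈ I, f i (w.1 (s + i)) ∂(P x) = ∫⁻ y, Φ y ∂(p s x) := by
  have := hp.isMarkovKernel
  have := hP.isProbabilityMeasure
  induction I using Finset.induction_on_max with
  | empty =>
    intro f hf
    exact ⟨fun _ => 1, measurable_const, fun x s => by simp⟩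
  | insert a I ha ih =>
    intro f hf
    have haI : a ∉ I := fun h => lt_irrefl _ (ha a h)
    rcases I.eq_empty_or_nonempty with rfl | hne
    · refine ⟨fun y => ∫⁻ z, f a z ∂(p a y), Measurable.lintegral_kernel (hf a), fun x s => ?_⟩
      simp only [insert_empty_eq, Finset.prod_singleton]
      rw [← lintegral_map (hf a) (measurable_eval_path (s + a)), hP.map_eval hp, hp.add, Kernel.lintegral_comp _ _ _ (hf a)]
    · set b := I.max' hne with hb
      have hbI : b ∈ I := I.max'_mem hne
      have hba : b ≤ a := (ha b hbI).le
      let g : S → ℝ≥0∞ := fun y => ∫⁻ z, f a z ∂(p (a - b) y)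
      have hg : Measurable g := Measurable.lintegral_kernel (hf a)
      -- The factor of the latest time is absorbed into the factor at time `b`.
      let f' : ℝ≥0 → S → ℝ≥0∞ := Function.update f b fun y => f b y * g y
      have hf' : ∀ i, Measurable (f' i) := fun i => by
        by_cases hi : i = b
        · rw [hi]
          simp only [f', Function.update_self]
          exact (hf b).mul hg
        · simpa [f', hi] using hf i
      obtain ⟨Φ, hΦ, h⟩ := ih f' hf'
      refine ⟨Φ, hΦ, fun x s => ?_⟩
      rw [← h x s]
      have hF : Measurable[pathFiltration S (s + b)] fun w : CadlagPath S =>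
          ∏ i ∈ I, f i (w.1 (s + i)) :=
        Finset.measurable_fun_prod _ fun i hi => (hf i).comp
          (measurable_eval_pathFiltration (add_le_add_right (I.le_max' i hi) s))
      have hM := (hP.markov x).lintegral_mul (fun t => measurable_eval_path t) (a - b) hF (hf a)
      have hs : s + b + (a - b) = s + a := by rw [add_assoc, add_tsub_cancel_of_le hba]
      rw [hs] at hM
      calc ∫⁻ w, ∏ i ∈ insert a I, f i (w.1 (s + i)) ∂(P x)
          = ∫⁻ w, (∏ i ∈ I, f i (w.1 (s + i))) * f a (w.1 (s + a)) ∂(P x) := by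
            refine lintegral_congr fun w => ?_
            rw [Finset.prod_insert haI, mul_comm]
        _ = ∫⁻ w, (∏ i ∈ I, f i (w.1 (s + i))) * g (w.1 (s + b)) ∂(P x) := hM
        _ = ∫⁻ w, ∏ i ∈ I, f' i (w.1 (s + i)) ∂(P x) := by
            refine lintegral_congr fun w => ?_
            rw [← Finset.mul_prod_erase I _ hbI, ← Finset.mul_prod_erase I _ hbI, mul_right_comm]
            congr 1
            · simp [f']
            · refine Finset.prod_congr rfl fun i hi => ?_
              rw [show f' i = f i from Function.update_of_ne (Finset.ne_of_mem_erase hi) _ _]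

/-- With `s = 0` the integral is `Φ x`, which gives measurability in `x`; with general `s` it gives
the law of the shifted path. -/
theorem IsCadlagMarkovFamily.exists_measure_cylinder (hp : IsMarkovSemigroup p)
    (hP : IsCadlagMarkovFamily p P) (I : Finset ℝ≥0) (A : ℝ≥0 → Set S)
    (hA : ∀ i, MeasurableSet (A i)) :
    ∃ Φ : S → ℝ≥0∞, Measurable Φ ∧ ∀ x s,
      P x {w | ∀ i ∈ I, w.1 (s + i) ∈ A i} = ∫⁻ y, Φ y ∂(p s x) := by
  obtain ⟨Φ, hΦ, h⟩ := hP.exists_lintegral_prod hp I (fun i => (A i).indicator 1)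
    fun i => measurable_one.indicator (hA i)
  refine ⟨Φ, hΦ, fun x s => ?_⟩
  rw [← h x s]
  have hm : MeasurableSet {w : CadlagPath S | ∀ i ∈ I, w.1 (s + i) ∈ A i} := by
    have : {w : CadlagPath S | ∀ i ∈ I, w.1 (s + i) ∈ A i} =
        ⋂ i ∈ I, (fun w : CadlagPath S => w.1 (s + i)) ⁻¹' A i := by
      ext w
      simp
    rw [this]
    exact Finset.measurableSet_biInter _ fun i _ => measurable_eval_path _ (hA i)
  rw [← lintegral_indicator_one hm]
  refine lintegral_congr fun w => ?_
  by_cases hw : ∀ i ∈ I, w.1 (s + i) ∈ A i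
  · rw [indicator_of_mem (show w ∈ {w : CadlagPath S | ∀ i ∈ I, w.1 (s + i) ∈ A i} from hw)]
    exact (Finset.prod_eq_one fun i hi => indicator_of_mem (hw i hi) _).symm
  · rw [indicator_of_notMem (show w ∉ {w : CadlagPath S | ∀ i ∈ I, w.1 (s + i) ∈ A i} from hw)]
    push Not at hw
    obtain ⟨i, hi, hwi⟩ := hw
    exact (Finset.prod_eq_zero hi (indicator_of_notMem hwi _)).symm

theorem IsMarkovSemigroup.lintegral_zero (hp : IsMarkovSemigroup p) {Φ : S → ℝ≥0∞}
    (hΦ : Measurable Φ) (x : S) : ∫⁻ y, Φ y ∂(p 0 x) = Φ x := by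
  rw [hp.zero, Kernel.id_apply, lintegral_dirac' _ hΦ]

theorem IsCadlagMarkovFamily.measurable (hp : IsMarkovSemigroup p)
    (hP : IsCadlagMarkovFamily p P) : Measurable P := by
  have := hP.isProbabilityMeasure
  refine measurable_measure_subtype_pi fun I A hA => ?_
  obtain ⟨Φ, hΦ, h⟩ := hP.exists_measure_cylinder hp I A hA
  convert hΦ using 2 with x
  have := h x 0
  simp only [zero_add] at this
  rw [this, hp.lintegral_zero hΦ]

/-- Both sides give the cylinders the mass `∫ Φ dp_s(x, ·)`, and cylinders determine a law on path
space. -/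
theorem IsCadlagMarkovFamily.map_shiftPath (hp : IsMarkovSemigroup p)
    (hP : IsCadlagMarkovFamily p P) (s : ℝ≥0) (x : S) :
    (P x).map (shiftPath s) = (p s x).bind P := by
  have := hp.isMarkovKernel
  have := hP.isProbabilityMeasure
  have hPm := hP.measurable hp
  have : IsProbabilityMeasure ((P x).map (shiftPath s)) :=
    Measure.isProbabilityMeasure_map (measurable_shiftPath s).aemeasurable
  have : IsProbabilityMeasure ((p s x).bind P) :=
    isProbabilityMeasure_bind hPm.aemeasurable (ae_of_all _ fun y => hP.isProbabilityMeasure y)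
  refine measure_subtype_pi_ext fun I A hA => ?_
  have hm : MeasurableSet {w : CadlagPath S | ∀ i ∈ I, w.1 i ∈ A i} := by
    have : {w : CadlagPath S | ∀ i ∈ I, w.1 i ∈ A i} =
        ⋂ i ∈ I, (fun w : CadlagPath S => w.1 i) ⁻¹' A i := by
      ext w
      simp
    rw [this]
    exact Finset.measurableSet_biInter _ fun i _ => measurable_eval_path _ (hA i)
  rw [Measure.map_apply (measurable_shiftPath s) hm, Measure.bind_apply hm hPm.aemeasurable]
  obtain ⟨Φ, hΦ, h⟩ := hP.exists_measure_cylinder hp I A hA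
  refine (h x s).trans (lintegral_congr fun y => ?_)
  have := h y 0
  simp only [zero_add] at this
  rw [this, hp.lintegral_zero hΦ]

end Family

/-! ### Escape from balls in short time intervals -/

section Exit

variable {X : Type u} [MetricSpace X] [SecondCountableTopology X] [MeasurableSpace X] [BorelSpace X]
  {p : ℝ≥0 → Kernel X X} {P : X → Measure (CadlagPath X)}

/-- The paths which, at some time in `(0, ε]`, have a distance of more than `R` from their starting
point. -/
def escapeSet (R : ℝ) (ε : ℝ≥0) : Set (CadlagPath X) :=
  {w | ∃ u, 0 < u ∧ u ≤ ε ∧ R < dist (w.1 u) (w.1 0)}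

/-- By right continuity an escape at a time `u < ε` persists for a while and is seen in a countable
dense set of times. The time `ε` is added separately, since times to its right do not count. -/
theorem measurableSet_escapeSet (R : ℝ) (ε : ℝ≥0) : MeasurableSet (escapeSet (X := X) R ε) := by
  obtain ⟨D, hDc, hD⟩ := TopologicalSpace.exists_countable_dense ℝ≥0
  have h : escapeSet (X := X) R ε = ⋃ u ∈ {u ∈ insert ε D | 0 < u ∧ u ≤ ε},
      {w : CadlagPath X | R < dist (w.1 u) (w.1 0)} := by
    ext w
    simp only [escapeSet, mem_ofPred_eq, mem_iUnion, exists_prop]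
    constructor
    · rintro ⟨u, hu0, hue, hu⟩
      rcases hue.eq_or_lt with rfl | hlt
      · exact ⟨u, ⟨mem_insert _ _, hu0, le_rfl⟩, hu⟩
      · have hc : ContinuousWithinAt (fun v => dist (w.1 v) (w.1 0)) (Ici u) u :=
          (w.2.1 u).dist continuousWithinAt_const
        have h1 : ∀ᶠ v in 𝓝[>] u, R < dist (w.1 v) (w.1 0) ∧ v < ε :=
          ((hc.eventually_const_lt hu).filter_mono (nhdsWithin_mono _ Ioi_subset_Ici_self)).and
            (Filter.Eventually.filter_mono nhdsWithin_le_nhds (Iio_mem_nhds hlt))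
        obtain ⟨c, hc, hsub⟩ := (mem_nhdsGT_iff_exists_Ioo_subset' hlt).1 h1
        obtain ⟨v, hvD, hv⟩ := hD.exists_between hc
        have hv' := hsub hv
        exact ⟨v, ⟨mem_insert_of_mem _ hvD, hu0.trans hv.1, hv'.2.le⟩, hv'.1⟩
    · rintro ⟨u, ⟨-, hu0, hue⟩, hu⟩
      exact ⟨u, hu0, hue, hu⟩
  rw [h]
  exact MeasurableSet.biUnion ((hDc.insert ε).mono fun u hu => hu.1) fun u _ =>
    measurableSet_lt measurable_const
      ((measurable_eval_path u).dist (measurable_eval_path 0))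

/-- The supremum over all starting points of the probabilities to leave the closed ball of
radius `R` until the time `ε`. -/
noncomputable def exitProb (P : X → Measure (CadlagPath X)) (ε R : ℝ) : ℝ≥0∞ :=
  ⨆ x, P x {w | exitTime x R w.1 ≤ ENNReal.ofReal ε}

theorem antitone_exitProb (ε : ℝ) : Antitone (exitProb P ε) := by
  intro R R' h
  refine iSup_mono fun x => measure_mono fun w hw => ?_
  refine le_trans ?_ (mem_ofPred_eq ▸ hw)
  refine le_iInf₂ fun t ht => iInf₂_le t ⟨ht.1, fun h' => ht.2 ?_⟩
  exact Metric.closedBall_subset_closedBall h h'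

theorem exitProb_le_one (hP : ∀ x, IsProbabilityMeasure (P x)) (ε R : ℝ) : exitProb P ε R ≤ 1 :=
  iSup_le fun _ => prob_le_one

/-- After the shift the path is distributed as a mixture of the laws `P y`; this is where a supremum
over all starting points is needed. -/
theorem IsCadlagMarkovFamily.measure_shiftPath_preimage_escapeSet_le (hp : IsMarkovSemigroup p)
    (hP : IsCadlagMarkovFamily p P) (x : X) (s ε : ℝ≥0) (R : ℝ) :
    P x (shiftPath s ⁻¹' escapeSet R ε) ≤ exitProb P ε R := by
  have := hp.isMarkovKernel
  have hE := measurableSet_escapeSet (X := X) R ε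
  rw [← Measure.map_apply (measurable_shiftPath s) hE, hP.map_shiftPath hp,
    Measure.bind_apply hE (hP.measurable hp).aemeasurable]
  have h : ∀ y, P y (escapeSet R ε) ≤ exitProb P ε R := by
    intro y
    refine le_trans (measure_mono_ae ?_)
      (le_iSup (fun y => P y {w | exitTime y R w.1 ≤ ENNReal.ofReal ε}) y)
    filter_upwards [hP.start y] with w hw
    rintro ⟨u, hu0, hue, hu⟩
    rw [hw] at hu
    change exitTime y R w.1 ≤ ENNReal.ofReal ε
    refine (iInf₂_le u ⟨hu0, fun h => absurd hu (not_lt.2 h)⟩).trans ?_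
    rw [ENNReal.ofReal_coe_nnreal]
    exact_mod_cast hue
  calc _ ≤ ∫⁻ _, exitProb P ε R ∂(p s x) := lintegral_mono h
    _ = _ := by simp

/-- Triangle inequality over `k` successive time blocks of length `ε`. -/
theorem dist_le_of_notMem_escapeSet {w : CadlagPath X} {ε : ℝ≥0} {R : ℝ} (hR : 0 ≤ R)
    {k : ℕ} (h : ∀ j < k, w ∉ shiftPath (j * ε) ⁻¹' escapeSet R ε) :
    ∀ t ≤ k * ε, dist (w.1 t) (w.1 0) ≤ k * R := by
  induction k with
  | zero =>
    intro t ht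
    have : t = 0 := by simpa using ht
    simp [this]
  | succ k ih =>
    have ih' := ih fun j hj => h j (by omega)
    intro t ht
    push_cast
    rcases le_or_gt t (k * ε) with hle | hlt
    · exact (ih' t hle).trans (by nlinarith)
    · have hk := h k (by omega)
      have h1 : dist (w.1 t) (w.1 (k * ε)) ≤ R := by
        by_contra hc
        refine hk ⟨t - k * ε, tsub_pos_of_lt hlt, ?_, ?_⟩
        · rw [tsub_le_iff_left]
          push_cast at ht
          linarith
        · change R < dist (w.1 (k * ε + (t - k * ε))) (w.1 (k * ε + 0))
          rw [add_tsub_cancel_of_le hlt.le, add_zero]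
          exact not_le.1 hc
      calc dist (w.1 t) (w.1 0) ≤ dist (w.1 t) (w.1 (k * ε)) + dist (w.1 (k * ε)) (w.1 0) :=
            dist_triangle _ _ _
        _ ≤ R + k * R := add_le_add h1 (ih' _ le_rfl)
        _ = _ := by ring

end Exit

/-! ### Displacement of the particles: Borel-Cantelli -/

section Displacement

variable {X : Type u} [MetricSpace X] [LocallyCompactSpace X] [SecondCountableTopology X]
  [CompleteSpace X] [MeasurableSpace X] [BorelSpace X] {vol : Measure X} {x₀ : X} {α : ℝ} {m : ℕ}
  {p : ℝ≥0 → Kernel X X} {P : X → Measure (CadlagPath X)}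

/-- If `R` is the integer part of the distance of the `n`-th point plus one, then `B(R)` contains at
least `n + 1` points, so `n + 1 ≤ K A R^(αm)`; solving for the distance gives the bound. -/
theorem exists_numeration_dist_ge (hG : GrowthBounds vol x₀ α m) (hα : 1 ≤ α) (hm : 1 ≤ m)
    (γ : Theta vol x₀ α) : ∃ y : ℕ → X, IsNumeration γ.1 y ∧ ∃ c : ℝ, 0 < c ∧
      ∀ᶠ n : ℕ in atTop, c * ((n : ℝ) + 1) ^ (1 / (α * m)) ≤ dist (y n) x₀ := by
  obtain ⟨N, -, hN, hcard⟩ := exists_measurable_numeration hG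
  refine ⟨N γ, hN γ, ?_⟩
  obtain ⟨K, hK⟩ := γ.2
  obtain ⟨A, hA⟩ := hG.upper
  have hm' : (1 : ℝ) ≤ m := by exact_mod_cast hm
  have ha : 0 < α * m := by positivity
  -- The summand 1 makes `M` positive even if `K * A = 0`.
  set M : ℝ := K * A + 1 with hM
  have hMpos : 0 < M := by positivity
  have hle : ∀ n : ℕ, (n : ℝ) + 1 ≤ M * (dist (N γ n) x₀ + 1) ^ (α * m) := by
    intro n
    set R : ℕ := ⌊dist (N γ n) x₀⌋₊ + 1 with hR
    have h1 : dist (N γ n) x₀ < R := by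
      rw [hR]
      push_cast
      exact Nat.lt_floor_add_one _
    have h2 : (R : ℝ) ≤ dist (N γ n) x₀ + 1 := by
      rw [hR]
      push_cast
      linarith [Nat.floor_le (dist_nonneg (x := N γ n) (y := x₀))]
    have hR1 : 1 ≤ R := by omega
    have h3 : ((n + 1 : ℕ) : ℝ≥0∞) ≤ K * (A * ENNReal.ofReal ((R : ℝ) ^ (α * m))) := by
      calc ((n + 1 : ℕ) : ℝ≥0∞) ≤ ((γ.1.1 ∩ Metric.closedBall x₀ R).encard : ℝ≥0∞) := by
            rw [← ENat.toENNReal_coe, ENat.toENNReal_le]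
            exact hcard γ n R h1
        _ ≤ K * vol (Metric.closedBall x₀ R) ^ α := hK R hR1
        _ ≤ _ := mul_le_mul_right (hA R hR1) _
    have h4 : (n : ℝ) + 1 ≤ K * (A * (R : ℝ) ^ (α * m)) := by
      have h5 := ENNReal.toReal_mono (by finiteness) h3
      rw [ENNReal.toReal_mul, ENNReal.toReal_mul, ENNReal.toReal_ofReal (by positivity),
        ENNReal.toReal_natCast] at h5
      simpa using h5
    calc (n : ℝ) + 1 ≤ K * A * (R : ℝ) ^ (α * m) := by rw [mul_assoc]; exact h4
      _ ≤ M * (R : ℝ) ^ (α * m) := mul_le_mul_of_nonneg_right (by linarith) (by positivity)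
      _ ≤ _ := mul_le_mul_of_nonneg_left (Real.rpow_le_rpow (by positivity) h2 ha.le) hMpos.le
  set b : ℝ := (1 / M) ^ (1 / (α * m)) with hb
  have hbpos : 0 < b := by positivity
  have hle' : ∀ n : ℕ, b * ((n : ℝ) + 1) ^ (1 / (α * m)) ≤ dist (N γ n) x₀ + 1 := by
    intro n
    rw [hb, ← Real.mul_rpow (by positivity) (by positivity), one_div (α * m)]
    rw [Real.rpow_inv_le_iff_of_pos (by positivity) (by positivity) ha, one_div,
      inv_mul_le_iff₀ hMpos]
    exact hle n
  have hlim : Tendsto (fun n : ℕ => b / 2 * ((n : ℝ) + 1) ^ (1 / (α * m))) atTop atTop :=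
    Tendsto.const_mul_atTop (by positivity) ((tendsto_rpow_atTop (by positivity)).comp
      (tendsto_atTop_add_const_right _ _ tendsto_natCast_atTop_atTop))
  -- Half of the lower bound for `dist + 1` is given away to absorb the 1, which is possible for
  -- large `n`.
  refine ⟨b / 2, by positivity, ?_⟩
  filter_upwards [hlim.eventually_ge_atTop 1] with n hn
  have := hle' n
  linarith

/-- The sum does not depend on the order of the points, so the numeration by distance may be used.
Finitely many terms are at most 1, and the others are compared with the assumption for `δ = κ c`. -/
theorem tsum_exitProb_dist_lt_top (hG : GrowthBounds vol x₀ α m) (hα : 1 ≤ α) (hm : 1 ≤ m)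
    (hP : ∀ x, IsProbabilityMeasure (P x)) {ε : ℝ}
    (hε : ∀ δ : ℝ, 0 < δ → ∑' n : ℕ, exitProb P ε (δ * ((n : ℝ) + 1) ^ (1 / (α * m))) < ∞)
    {γ : Theta vol x₀ α} {x : ℕ → X} (hx : IsNumeration γ.1 x) {κ : ℝ} (hκ : 0 < κ) :
    ∑' n, exitProb P ε (κ * dist (x n) x₀) < ∞ := by
  obtain ⟨y, hy, c, hc, hev⟩ := exists_numeration_dist_ge hG hα hm γ
  obtain ⟨σ, rfl⟩ := hy.exists_equiv hx
  rw [show ∑' n, exitProb P ε (κ * dist ((y ∘ σ) n) x₀) = ∑' n, exitProb P ε (κ * dist (y n) x₀)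
    from σ.tsum_eq fun n => exitProb P ε (κ * dist (y n) x₀)]
  obtain ⟨n₀, hn₀⟩ := eventually_atTop.1 hev
  have hle : ∀ n, exitProb P ε (κ * dist (y n) x₀) ≤ (if n ∈ Finset.range n₀ then 1 else 0) +
      exitProb P ε (κ * c * ((n : ℝ) + 1) ^ (1 / (α * m))) := by
    intro n
    by_cases hn : n < n₀
    · rw [if_pos (Finset.mem_range.2 hn)]
      exact (exitProb_le_one hP _ _).trans le_self_add
    · refine (antitone_exitProb ε ?_).trans le_add_self
      rw [mul_assoc]
      exact mul_le_mul_of_nonneg_left (hn₀ n (not_lt.1 hn)) hκ.le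
  refine (ENNReal.tsum_le_tsum hle).trans_lt ?_
  rw [ENNReal.tsum_add]
  refine ENNReal.add_lt_top.2 ⟨?_, hε _ (mul_pos hκ hc)⟩
  rw [tsum_eq_sum (s := Finset.range n₀) fun n hn => if_neg hn]
  exact ENNReal.sum_lt_top.2 fun n _ => by split_ifs; simp

/-- Almost surely, up to any time all but finitely many particles cover at most half of their
initial distance from `x₀`. -/
theorem ae_finite_setOf_displacement (hG : GrowthBounds vol x₀ α m) (hα : 1 ≤ α) (hm : 1 ≤ m)
    (hp : IsMarkovSemigroup p) (hP : IsCadlagMarkovFamily p P) (hexit : ExitSummable P α m)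
    {γ : Theta vol x₀ α} {x : ℕ → X} (hx : IsNumeration γ.1 x) :
    ∀ᵐ w ∂(Measure.infinitePi fun n => P (x n)), ∀ T : ℝ≥0,
      {n | ¬ ∀ t ≤ T, dist ((w n).1 t) (x n) ≤ dist (x n) x₀ / 2}.Finite := by
  have hprob := hP.isProbabilityMeasure
  obtain ⟨ε, hε, hsum⟩ := hexit
  lift ε to ℝ≥0 using hε.le
  have hε' : 0 < ε := by exact_mod_cast hε
  have hstart : ∀ᵐ w ∂(Measure.infinitePi fun n => P (x n)), ∀ n, (w n).1 0 = x n :=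
    ae_all_iff.2 fun n => (measurePreserving_eval_infinitePi (fun n => P (x n)) n)
      |>.quasiMeasurePreserving.ae (hP.start (x n))
  -- A time `T` is covered by `k + 1` blocks of length `ε`; allowing the fraction `1/(2(k+1))` of
  -- the initial distance in each block makes one half in total. `B k j n` is the event that
  -- particle `n` violates this in block `j`.
  have hκ : ∀ k : ℕ, (0 : ℝ) < 1 / (2 * ((k : ℝ) + 1)) := fun k => by positivity
  let B : ℕ → ℕ → ℕ → Set (ℕ → CadlagPath X) := fun k j n => (fun w => w n) ⁻¹'
    (shiftPath (j * ε) ⁻¹' escapeSet (1 / (2 * ((k : ℝ) + 1)) * dist (x n) x₀) ε)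
  have hB : ∀ k j n, (Measure.infinitePi fun n => P (x n)) (B k j n) ≤
      exitProb P ε (1 / (2 * ((k : ℝ) + 1)) * dist (x n) x₀) := by
    intro k j n
    rw [← Measure.map_apply (measurable_pi_apply n)
      (measurable_shiftPath _ (measurableSet_escapeSet _ _)), Measure.infinitePi_map_eval]
    exact hP.measure_shiftPath_preimage_escapeSet_le hp _ _ _ _
  -- Borel-Cantelli, for the countably many pairs `(k, j)` at once.
  have hfin : ∀ᵐ w ∂(Measure.infinitePi fun n => P (x n)), ∀ k j : ℕ, {n | w ∈ B k j n}.Finite := by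
    refine ae_all_iff.2 fun k => ae_all_iff.2 fun j => ae_finite_setOfPred_mem ?_
    exact ((ENNReal.tsum_le_tsum (hB k j)).trans_lt
      (tsum_exitProb_dist_lt_top hG hα hm hprob hsum hx (hκ k))).ne
  filter_upwards [hstart, hfin] with w h0 hw T
  obtain ⟨k, hk⟩ := exists_nat_ge (T / ε)
  have hT : T ≤ ((k + 1 : ℕ) : ℝ≥0) * ε := by
    rw [div_le_iff₀ hε'] at hk
    exact hk.trans (mul_le_mul_left (by simp) _)
  refine ((finite_lt_nat (k + 1)).biUnion fun j _ => hw k j).subset fun n hn => ?_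
  by_contra hc
  simp only [mem_iUnion, mem_ofPred_eq, not_exists] at hc
  refine hn fun t ht => ?_
  have h := dist_le_of_notMem_escapeSet (w := w n) (ε := ε) (k := k + 1)
    (mul_nonneg (hκ k).le dist_nonneg) (fun j hj => hc j hj) t (ht.trans hT)
  rw [h0] at h
  refine h.trans (le_of_eq ?_)
  push_cast
  field_simp

end Displacement

/-! ### Path regularity from the displacement bound -/

section Regularity

variable {X : Type u} [MetricSpace X] [MeasurableSpace X] {vol : Measure X} {x₀ : X} {α : ℝ} {m : ℕ}

/-- A nonexceptional particle found in `B(r)` satisfies `dist (x n) x₀ ≤ r + dist (x n) x₀ / 2`, so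
it started in `B(2r)`; doubling returns to `B(r)`. The points `y` will be positions or left limits.
-/
theorem exists_encard_le_of_finite_displacement (hG : GrowthBounds vol x₀ α m)
    {γ : Theta vol x₀ α} {x y : ℕ → X} (hx : IsNumeration γ.1 x)
    (hy : {n | ¬ dist (y n) (x n) ≤ dist (x n) x₀ / 2}.Finite) :
    ∃ K : ℕ, ∀ r : ℕ, 1 ≤ r → ({n | y n ∈ Metric.closedBall x₀ r}.encard : ℝ≥0∞) ≤
      K * vol (Metric.closedBall x₀ r) ^ α := by
  obtain ⟨K, hK⟩ := γ.2
  obtain ⟨L, hL⟩ := hG.double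
  set F := {n | ¬ dist (y n) (x n) ≤ dist (x n) x₀ / 2} with hF
  obtain ⟨K', hK'⟩ := hG.lower F.ncard
  refine ⟨K' + K * L, fun r hr => ?_⟩
  have hsub : {n | y n ∈ Metric.closedBall x₀ r} ⊆
      F ∪ {n | x n ∈ Metric.closedBall x₀ ((2 * r : ℕ) : ℝ)} := by
    intro n hn
    by_cases h : n ∈ F
    · exact Or.inl h
    · refine Or.inr ?_
      have h1 : dist (y n) (x n) ≤ dist (x n) x₀ / 2 := not_not.1 h
      have h2 : dist (y n) x₀ ≤ r := hn
      have h3 := dist_triangle_left (x n) x₀ (y n)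
      change dist (x n) x₀ ≤ _
      push_cast
      linarith
  calc ({n | y n ∈ Metric.closedBall x₀ r}.encard : ℝ≥0∞)
      ≤ ((F.encard + {n | x n ∈ Metric.closedBall x₀ ((2 * r : ℕ) : ℝ)}.encard : ℕ∞) : ℝ≥0∞) :=
        ENat.toENNReal_le.2 ((encard_le_encard hsub).trans (encard_union_le _ _))
    _ = (F.ncard : ℝ≥0∞) + {n | x n ∈ Metric.closedBall x₀ ((2 * r : ℕ) : ℝ)}.encard := by
        rw [ENat.toENNReal_add, ← hy.cast_ncard_eq]
        simp
    _ ≤ K' * vol (Metric.closedBall x₀ r) ^ α + K * (L * vol (Metric.closedBall x₀ r) ^ α) := by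
        refine add_le_add (hK' r hr) ?_
        rw [← hx.encard_inter]
        exact (hK (2 * r) (by omega)).trans (mul_le_mul_right (hL r hr) _)
    _ = _ := by
        push_cast
        ring

/-- The properties of the paths of the particles that hold almost surely and that imply the
regularity of the path of the configuration. -/
structure IsGoodFamily (x₀ : X) (x : ℕ → X) (w : ℕ → CadlagPath X) : Prop where
  start : ∀ n, (w n).1 0 = x n
  injective : ∀ t, Function.Injective fun n => (w n).1 t
  finite : ∀ T : ℝ≥0, {n | ¬ ∀ t ≤ T, dist ((w n).1 t) (x n) ≤ dist (x n) x₀ / 2}.Finite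

theorem IsGoodFamily.mem_thetaSeq (hG : GrowthBounds vol x₀ α m) {γ : Theta vol x₀ α} {x : ℕ → X}
    (hx : IsNumeration γ.1 x) {w : ℕ → CadlagPath X} (hw : IsGoodFamily x₀ x w) (t : ℝ≥0) :
    (fun n => (w n).1 t) ∈ thetaSeq vol x₀ α :=
  ⟨hw.injective t, exists_encard_le_of_finite_displacement hG hx
    ((hw.finite t).subset fun _ hn h => hn (h t le_rfl))⟩

/-- Up to time `T` only the finitely many particles in `F` can visit the support of `φ`, so the
limit is taken in a finite sum. The filter `l` stands for approach to a time from the right or from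
the left. -/
theorem IsGoodFamily.tendsto_vagueSum (hG : GrowthBounds vol x₀ α m) {γ : Theta vol x₀ α}
    {x : ℕ → X} (hx : IsNumeration γ.1 x) {w : ℕ → CadlagPath X} (hw : IsGoodFamily x₀ x w)
    {Z : ℝ≥0 → Theta vol x₀ α} (hZ : ∀ t, IsNumeration (Z t).1 fun n => (w n).1 t)
    {l : Filter ℝ≥0} [l.NeBot] {T : ℝ≥0} (hT : ∀ᶠ s in l, s ≤ T) {y : ℕ → X}
    (hy : ∀ n, Tendsto (w n).1 l (𝓝 (y n))) (φ : CompactlySupportedContinuousMap X ℝ) :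
    Tendsto (fun s => ∑' z : (Z s).1.1, φ z) l (𝓝 (∑' n, φ (y n))) := by
  obtain ⟨r, hr, hφ⟩ := exists_nat_closedBall_superset x₀ φ.hasCompactSupport
  have hfin : ({n | ¬ ∀ t ≤ T, dist ((w n).1 t) (x n) ≤ dist (x n) x₀ / 2} ∪
      {n | x n ∈ Metric.closedBall x₀ ((2 * r : ℕ) : ℝ)}).Finite := by
    refine (hw.finite T).union ?_
    have h := hx.encard_inter (Metric.closedBall x₀ ((2 * r : ℕ) : ℝ))
    rw [← encard_lt_top_iff, ← h, encard_lt_top_iff]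
    exact finite_inter_closedBall hG γ (2 * r)
  set F := hfin.toFinset with hF
  have hout : ∀ n ∉ F, ∀ t ≤ T, φ ((w n).1 t) = 0 := by
    intro n hn t ht
    rw [hF, Finite.mem_toFinset, mem_union, not_or] at hn
    have h1 := not_not.1 hn.1 t ht
    have h2 : ¬ dist (x n) x₀ ≤ ((2 * r : ℕ) : ℝ) := hn.2
    push_cast at h2
    have h3 := dist_triangle_left (x n) x₀ ((w n).1 t)
    refine image_eq_zero_of_notMem_tsupport fun h => ?_
    have h4 : dist ((w n).1 t) x₀ ≤ r := hφ h
    linarith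
  have hlim : ∀ n, Tendsto (fun s => φ ((w n).1 s)) l (𝓝 (φ (y n))) := fun n =>
    (φ.continuous.tendsto _).comp (hy n)
  -- The remaining particles contribute nothing to the limit either, as limits of values that vanish
  -- eventually along `l`.
  have hout' : ∀ n ∉ F, φ (y n) = 0 := fun n hn =>
    tendsto_nhds_unique (hlim n)
      ((tendsto_congr' (hT.mono fun s hs => hout n hn s hs)).2 tendsto_const_nhds)
  rw [tsum_eq_sum hout']
  refine (tendsto_congr' ?_).2 (tendsto_finsetSum F fun n _ => hlim n)
  filter_upwards [hT] with s hs
  exact (vagueSum_eq_tsum_of_isNumeration (hZ s) φ).trans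
    (tsum_eq_sum fun n hn => hout n hn s hs)

theorem IsGoodFamily.continuousWithinAt (hG : GrowthBounds vol x₀ α m) {γ : Theta vol x₀ α}
    {x : ℕ → X} (hx : IsNumeration γ.1 x) {w : ℕ → CadlagPath X} (hw : IsGoodFamily x₀ x w)
    {Z : ℝ≥0 → Theta vol x₀ α} (hZ : ∀ t, IsNumeration (Z t).1 fun n => (w n).1 t) (t : ℝ≥0) :
    ContinuousWithinAt Z (Ici t) t := by
  refine tendsto_subtype_rng.2 (tendsto_config_iff.2 fun φ => ?_)
  rw [vagueSum_eq_tsum_of_isNumeration (hZ t)]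
  -- Approach from the right needs a time horizon beyond `t`.
  refine hw.tendsto_vagueSum hG hx hZ (T := t + 1) ?_ (fun n => (w n).2.1 t) φ
  exact Filter.Eventually.filter_mono nhdsWithin_le_nhds
    (Iic_mem_nhds (lt_add_of_pos_right t one_pos))

theorem IsGoodFamily.exists_tendsto (hG : GrowthBounds vol x₀ α m) {γ : Theta vol x₀ α}
    {x : ℕ → X} (hx : IsNumeration γ.1 x) {w : ℕ → CadlagPath X} (hw : IsGoodFamily x₀ x w)
    {t : ℝ≥0} (ht : 0 < t) : ∃ y : ℕ → X, (∀ n, Tendsto (w n).1 (𝓝[<] t) (𝓝 (y n))) ∧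
      ∃ K : ℕ, ∀ r : ℕ, 1 ≤ r → ({n | y n ∈ Metric.closedBall x₀ r}.encard : ℝ≥0∞) ≤
        K * vol (Metric.closedBall x₀ r) ^ α := by
  have : (𝓝[<] t).NeBot := nhdsLT_neBot_of_exists_lt ⟨0, ht⟩
  choose y hy using fun n => (w n).2.2 t ht
  refine ⟨y, hy, exists_encard_le_of_finite_displacement hG hx
    ((hw.finite t).subset fun n hn h => hn ?_)⟩
  -- The displacement bound is a closed condition, so the left limits satisfy it too.
  exact le_of_tendsto ((hy n).dist tendsto_const_nhds)
    (eventually_mem_nhdsWithin.mono fun s hs => h s (mem_Iio.1 hs).le)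

theorem IsGoodFamily.isCadlagMultiple (hG : GrowthBounds vol x₀ α m) {γ : Theta vol x₀ α}
    {x : ℕ → X} (hx : IsNumeration γ.1 x) {w : ℕ → CadlagPath X} (hw : IsGoodFamily x₀ x w)
    {Z : ℝ≥0 → Theta vol x₀ α} (hZ : ∀ t, IsNumeration (Z t).1 fun n => (w n).1 t) :
    IsCadlagMultiple vol x₀ α Z := by
  refine ⟨hw.continuousWithinAt hG hx hZ, fun t ht => ?_⟩
  have : (𝓝[<] t).NeBot := nhdsLT_neBot_of_exists_lt ⟨0, ht⟩
  obtain ⟨y, hy, hK⟩ := hw.exists_tendsto hG hx ht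
  exact ⟨y, fun K hKc => finite_setOf_mem_isCompact hG hK hKc, hK, fun φ =>
    hw.tendsto_vagueSum hG hx hZ (T := t)
      (eventually_mem_nhdsWithin.mono fun s hs => (mem_Iio.1 hs).le) hy φ⟩

/-- If the left limits of the particles are distinct, they enumerate an element of `Θ_α`, which is
then the vague limit. -/
theorem IsGoodFamily.isCadlag (hG : GrowthBounds vol x₀ α m) {γ : Theta vol x₀ α}
    {x : ℕ → X} (hx : IsNumeration γ.1 x) {w : ℕ → CadlagPath X} (hw : IsGoodFamily x₀ x w)
    {Z : ℝ≥0 → Theta vol x₀ α} (hZ : ∀ t, IsNumeration (Z t).1 fun n => (w n).1 t)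
    (hl : ∀ i j, i ≠ j → ∀ t, 0 < t →
      ¬ ∃ z, Tendsto (w i).1 (𝓝[<] t) (𝓝 z) ∧ Tendsto (w j).1 (𝓝[<] t) (𝓝 z)) :
    IsCadlag Z := by
  refine ⟨hw.continuousWithinAt hG hx hZ, fun t ht => ?_⟩
  have : (𝓝[<] t).NeBot := nhdsLT_neBot_of_exists_lt ⟨0, ht⟩
  obtain ⟨y, hy, hK⟩ := hw.exists_tendsto hG hx ht
  have hinj : Function.Injective y := fun i j hij => by
    by_contra hne
    exact hl i j hne t ht ⟨y i, hy i, hij ▸ hy j⟩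
  obtain ⟨γ', hγ'⟩ := exists_isNumeration_of_mem_thetaSeq hG (⟨hinj, hK⟩ : y ∈ thetaSeq vol x₀ α)
  refine ⟨γ', tendsto_subtype_rng.2 (tendsto_config_iff.2 fun φ => ?_)⟩
  rw [vagueSum_eq_tsum_of_isNumeration hγ']
  exact hw.tendsto_vagueSum hG hx hZ (T := t)
      (eventually_mem_nhdsWithin.mono fun s hs => (mem_Iio.1 hs).le) hy φ

end Regularity

/-! ### Independent Markov processes: the Markov property of the product -/

section ProductMarkov

variable {Ω S : Type*} {F : MeasurableSpace Ω} {mΩ : MeasurableSpace Ω} [MeasurableSpace S]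

theorem lintegral_infinitePi_prod {Q : ℕ → Measure Ω} [∀ n, IsProbabilityMeasure (Q n)]
    (I : Finset ℕ) {f : ℕ → Ω → ℝ≥0∞} (hf : ∀ n, Measurable (f n)) :
    ∫⁻ w, ∏ n ∈ I, f n (w n) ∂(Measure.infinitePi Q) = ∏ n ∈ I, ∫⁻ a, f n a ∂(Q n) := by
  rw [lintegral_prod_eq_prod_lintegral_of_indepFun I (fun n (w : ℕ → Ω) => f n (w n))
    (iIndepFun_infinitePi hf) fun n => (hf n).comp (measurable_pi_apply n)]
  refine Finset.prod_congr rfl fun n _ => ?_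
  rw [← lintegral_map (hf n) (measurable_pi_apply n), Measure.infinitePi_map_eval]

/-- Both sides are finite measures in `E`. On cylinders they factorize over the coordinates, and the
factors agree by the Markov property `h` of the single coordinate. -/
theorem measure_infinitePi_inter_rectangle {Q : ℕ → Measure Ω} [∀ n, IsProbabilityMeasure (Q n)]
    (hF : F ≤ mΩ) {U V : Ω → S} (hU : Measurable U) (hV : Measurable V)
    {κ : Kernel S S} [IsMarkovKernel κ]
    (h : ∀ n B, MeasurableSet[F] B → ∀ A, MeasurableSet A →
      Q n (B ∩ V ⁻¹' A) = ∫⁻ w in B, κ (U w) A ∂(Q n))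
    (I : Finset ℕ) {B : ℕ → Set Ω} (hB : ∀ n, MeasurableSet[F] (B n))
    {E : Set (ℕ → S)} (hE : MeasurableSet E) :
    Measure.infinitePi Q ((I : Set ℕ).pi B ∩ {w | (fun n => V (w n)) ∈ E}) =
      ∫⁻ w in (I : Set ℕ).pi B, Measure.infinitePi (fun n => κ (U (w n))) E
        ∂(Measure.infinitePi Q) := by
  classical
  have hB' : ∀ n, MeasurableSet (B n) := fun n => hF _ (hB n)
  have hR : MeasurableSet ((I : Set ℕ).pi B) := MeasurableSet.pi I.countable_toSet fun n _ => hB' n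
  have hκ : Measurable fun y : ℕ → S => Measure.infinitePi fun n => κ (y n) :=
    measurable_infinitePi κ.measurable
  have hUp : Measurable fun (w : ℕ → Ω) n => U (w n) := by fun_prop
  have hVp : Measurable fun (w : ℕ → Ω) n => V (w n) := by fun_prop
  set Q' := (Measure.infinitePi Q).restrict ((I : Set ℕ).pi B) with hQ'
  have hbind : ∀ E, MeasurableSet E →
      ((Q'.map fun w n => U (w n)).bind fun y => Measure.infinitePi fun n => κ (y n)) E =
        ∫⁻ w in (I : Set ℕ).pi B, Measure.infinitePi (fun n => κ (U (w n))) E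
          ∂(Measure.infinitePi Q) := fun E hE => by
    rw [Measure.bind_apply hE hκ.aemeasurable]
    exact lintegral_map ((Measure.measurable_coe hE).comp hκ) hUp
  have hmap : ∀ E, MeasurableSet E → (Q'.map fun w n => V (w n)) E =
      Measure.infinitePi Q ((I : Set ℕ).pi B ∩ {w | (fun n => V (w n)) ∈ E}) := fun E hE => by
    rw [Measure.map_apply hVp hE, hQ', Measure.restrict_apply (hVp hE), inter_comm]
    rfl
  rw [← hbind E hE, ← hmap E hE]
  congr 1
  refine ext_of_generate_finite _ generateFrom_squareCylinders.symm (isPiSystem_squareCylinders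
      (fun i => MeasurableSpace.isPiSystem_measurableSet) fun i => MeasurableSet.univ) ?_ ?_
  · rintro _ ⟨J, A, hA, rfl⟩
    have hA' : ∀ i, MeasurableSet (A i) := fun i => hA i (mem_univ i)
    have hJ : MeasurableSet ((J : Set ℕ).pi A) :=
      MeasurableSet.pi J.countable_toSet fun n _ => hA' n
    rw [hbind _ hJ, hmap _ hJ]
    -- Padding with `univ` brings both rectangles to the common index set `I ∪ J`.
    let B₁ : ℕ → Set Ω := fun n => if n ∈ I then B n else univ
    let A₁ : ℕ → Set S := fun n => if n ∈ J then A n else univ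
    have hB₁ : ∀ n, MeasurableSet[F] (B₁ n) := fun n => by
      by_cases hn : n ∈ I
      · simpa [B₁, hn] using hB n
      · simp [B₁, hn]
    have hA₁ : ∀ n, MeasurableSet (A₁ n) := fun n => by
      by_cases hn : n ∈ J
      · simpa [A₁, hn] using hA' n
      · simp [A₁, hn]
    have hset : (I : Set ℕ).pi B ∩ {w | (fun n => V (w n)) ∈ (J : Set ℕ).pi A} =
        ((I ∪ J : Finset ℕ) : Set ℕ).pi fun n => B₁ n ∩ V ⁻¹' A₁ n := by
      ext w
      simp only [mem_inter_iff, Set.mem_pi, Finset.mem_coe, mem_ofPred_eq, Finset.mem_union,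
        mem_preimage, B₁, A₁]
      refine ⟨fun h n _ => ⟨?_, ?_⟩, fun h => ⟨fun n hn => ?_, fun n hn => ?_⟩⟩
      · split_ifs with hn
        exacts [h.1 n hn, mem_univ _]
      · split_ifs with hn
        exacts [h.2 n hn, mem_univ _]
      · simpa [hn] using (h n (Or.inl hn)).1
      · simpa [hn] using (h n (Or.inr hn)).2
    rw [hset, Measure.infinitePi_pi _ fun n _ => (hF _ (hB₁ n)).inter (hV (hA₁ n)),
      ← lintegral_indicator hR]
    have hprod : ∀ w : ℕ → Ω, ((I : Set ℕ).pi B).indicator (fun w =>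
        Measure.infinitePi (fun n => κ (U (w n))) ((J : Set ℕ).pi A)) w =
        ∏ n ∈ I ∪ J, (B₁ n).indicator (fun a => κ (U a) (A₁ n)) (w n) := by
      intro w
      rw [Set.indicator_apply]
      split_ifs with hw
      · have h1 : (J : Set ℕ).pi A = ((I ∪ J : Finset ℕ) : Set ℕ).pi A₁ := by
          ext y
          simp only [Set.mem_pi, Finset.mem_coe, Finset.mem_union, A₁]
          refine ⟨fun h n _ => ?_, fun h n hn => ?_⟩
          · split_ifs with hn
            exacts [h n hn, mem_univ _]
          · simpa [hn] using h n (Or.inr hn)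
        rw [h1, Measure.infinitePi_pi _ fun n _ => hA₁ n]
        refine Finset.prod_congr rfl fun n _ =>
          (indicator_of_mem (f := fun a => κ (U a) (A₁ n)) ?_).symm
        simp only [B₁]
        split_ifs with hn
        exacts [hw n hn, mem_univ _]
      · simp only [Set.mem_pi, not_forall] at hw
        obtain ⟨n, hn, hwn⟩ := hw
        have hwn' : w n ∉ B₁ n := by simpa [B₁, Finset.mem_coe.1 hn] using hwn
        exact (Finset.prod_eq_zero (Finset.mem_union_left _ hn)
          (indicator_of_notMem hwn' _)).symm
    simp only [hprod]
    rw [lintegral_infinitePi_prod (f := fun n => (B₁ n).indicator fun a => κ (U a) (A₁ n)) _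
      fun n => (((κ.measurable_coe (hA₁ n)).comp hU).indicator (hF _ (hB₁ n)))]
    refine Finset.prod_congr rfl fun n _ => ?_
    rw [lintegral_indicator (hF _ (hB₁ n)), h n _ (hB₁ n) _ (hA₁ n)]
  · rw [hbind _ MeasurableSet.univ, hmap _ MeasurableSet.univ]
    simp

/-- Both sides are finite measures in `B` on the product of the σ-algebras `F`, and the rectangles
on which they agree generate it. -/
theorem measure_infinitePi_inter {Q : ℕ → Measure Ω} [∀ n, IsProbabilityMeasure (Q n)]
    (hF : F ≤ mΩ) {U V : Ω → S} (hU : Measurable U) (hV : Measurable V)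
    {κ : Kernel S S} [IsMarkovKernel κ]
    (h : ∀ n B, MeasurableSet[F] B → ∀ A, MeasurableSet A →
      Q n (B ∩ V ⁻¹' A) = ∫⁻ w in B, κ (U w) A ∂(Q n))
    {B : Set (ℕ → Ω)} (hB : MeasurableSet[@MeasurableSpace.pi ℕ (fun _ => Ω) fun _ => F] B)
    {E : Set (ℕ → S)} (hE : MeasurableSet E) :
    Measure.infinitePi Q (B ∩ {w | (fun n => V (w n)) ∈ E}) =
      ∫⁻ w in B, Measure.infinitePi (fun n => κ (U (w n))) E ∂(Measure.infinitePi Q) := by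
  have hle : (@MeasurableSpace.pi ℕ (fun _ => Ω) fun _ => F) ≤ MeasurableSpace.pi :=
    iSup_mono fun n => MeasurableSpace.comap_mono hF
  have hκ : Measurable fun y : ℕ → S => Measure.infinitePi fun n => κ (y n) :=
    measurable_infinitePi κ.measurable
  have hg : Measurable fun w : ℕ → Ω => Measure.infinitePi (fun n => κ (U (w n))) E :=
    ((Measure.measurable_coe hE).comp hκ).comp (by fun_prop : Measurable fun (w : ℕ → Ω) n => U (w n))
  have hVp : Measurable fun (w : ℕ → Ω) n => V (w n) := by fun_prop
  have hVE : MeasurableSet {w : ℕ → Ω | (fun n => V (w n)) ∈ E} := hVp hE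
  have hfin : IsFiniteMeasure ((Measure.infinitePi Q).withDensity fun w =>
      Measure.infinitePi (fun n => κ (U (w n))) E) := by
    refine isFiniteMeasure_withDensity (((lintegral_mono fun w => prob_le_one).trans_lt ?_).ne)
    simp
  have key : ((Measure.infinitePi Q).restrict {w | (fun n => V (w n)) ∈ E}).trim hle =
      ((Measure.infinitePi Q).withDensity fun w =>
        Measure.infinitePi (fun n => κ (U (w n))) E).trim hle := by
    have hrect : ∀ (I : Finset ℕ) (B : ℕ → Set Ω), (∀ n, MeasurableSet[F] (B n)) →
        ((Measure.infinitePi Q).restrict {w | (fun n => V (w n)) ∈ E}).trim hle ((I : Set ℕ).pi B) =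
          ((Measure.infinitePi Q).withDensity fun w =>
            Measure.infinitePi (fun n => κ (U (w n))) E).trim hle ((I : Set ℕ).pi B) := by
      intro I B hB
      have hR : MeasurableSet[@MeasurableSpace.pi ℕ (fun _ => Ω) fun _ => F] ((I : Set ℕ).pi B) :=
        @MeasurableSet.pi _ _ (fun _ => F) _ _ I.countable_toSet fun n _ => hB n
      rw [trim_measurableSet_eq hle hR, trim_measurableSet_eq hle hR,
        Measure.restrict_apply (hle _ hR), withDensity_apply _ (hle _ hR),
        measure_infinitePi_inter_rectangle hF hU hV h I hB hE]
    refine @ext_of_generate_finite _ (@MeasurableSpace.pi ℕ (fun _ => Ω) fun _ => F) _ _ _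
      (@generateFrom_squareCylinders _ _ fun _ => F).symm
      (isPiSystem_squareCylinders (fun i => @MeasurableSpace.isPiSystem_measurableSet _ F)
        fun i => MeasurableSet.univ) ?_ ?_ ?_
    · infer_instance
    · rintro _ ⟨I, B, hB, rfl⟩
      exact hrect I B fun n => hB n (mem_univ n)
    · simpa using hrect ∅ (fun _ => univ) fun _ => MeasurableSet.univ
  have h1 := congrArg (fun μ : @Measure _ (@MeasurableSpace.pi ℕ (fun _ => Ω) fun _ => F) => μ B) key
  simp only [trim_measurableSet_eq hle hB] at h1
  rwa [Measure.restrict_apply (hle _ hB), withDensity_apply _ (hle _ hB)] at h1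

end ProductMarkov

/-! ### The path space of the configuration process -/

section ConfigPath

variable {X : Type u} [MetricSpace X] [MeasurableSpace X]

theorem IsCadlagMultiple.const_add {vol : Measure X} {x₀ : X} {α : ℝ} {w : ℝ≥0 → Theta vol x₀ α}
    (hw : IsCadlagMultiple vol x₀ α w) (s : ℝ≥0) :
    IsCadlagMultiple vol x₀ α fun t => w (s + t) := by
  refine ⟨fun t => continuousWithinAt_const_add (hw.1 _), fun t ht => ?_⟩
  obtain ⟨y, hy, hK, hφ⟩ := hw.2 (s + t) (by positivity)
  exact ⟨y, hy, hK, fun φ => (hφ φ).comp (tendsto_const_add_nhdsLT s t)⟩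

theorem isCadlag_const {S : Type u} [TopologicalSpace S] (γ : S) : IsCadlag fun _ => γ :=
  ⟨fun _ => continuousWithinAt_const, fun _ _ => ⟨γ, tendsto_const_nhds⟩⟩

/-- The paths in `Θ_α` which are cadlag with left limits that may be multiple configurations, and
even cadlag in `Θ_α` if `L` holds. -/
abbrev ConfigPath (vol : Measure X) (x₀ : X) (α : ℝ) (L : Prop) : Type u :=
  {w : ℝ≥0 → Theta vol x₀ α // IsCadlagMultiple vol x₀ α w ∧ (L → IsCadlag w)}

variable {vol : Measure X} {x₀ : X} {α : ℝ} {m : ℕ} {L : Prop}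

theorem isCadlagMultiple_const (hG : GrowthBounds vol x₀ α m) {γ : Theta vol x₀ α} {x : ℕ → X}
    (hx : IsNumeration γ.1 x) : IsCadlagMultiple vol x₀ α fun _ => γ := by
  refine ⟨fun t => continuousWithinAt_const, fun t _ => ⟨x, fun K hK =>
    finite_setOf_mem_isCompact hG hx.mem_thetaSeq.2 hK, hx.mem_thetaSeq.2, fun φ => ?_⟩⟩
  rw [← vagueSum_eq_tsum_of_isNumeration hx]
  exact tendsto_const_nhds

/-- The path `t ↦ w(s + t)`. -/
def ConfigPath.shift (s : ℝ≥0) (w : ConfigPath vol x₀ α L) : ConfigPath vol x₀ α L :=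
  ⟨fun t => w.1 (s + t), w.2.1.const_add s, fun h => (w.2.2 h).const_add s⟩

theorem ConfigPath.measurable_eval (t : ℝ≥0) :
    Measurable fun w : ConfigPath vol x₀ α L => w.1 t :=
  (measurable_pi_apply t).comp measurable_subtype_coe

theorem ConfigPath.measurable_shift (s : ℝ≥0) :
    Measurable (ConfigPath.shift (vol := vol) (x₀ := x₀) (α := α) (L := L) s) :=
  Measurable.subtype_mk (measurable_pi_lambda _ fun t => measurable_eval (s + t))

/-- The filtration `σ(w(s), s ≤ t)`. -/
noncomputable def ConfigPath.filtration (vol : Measure X) (x₀ : X) (α : ℝ) (L : Prop) :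
    Filtration ℝ≥0 (inferInstance : MeasurableSpace (ConfigPath vol x₀ α L)) where
  seq t := ⨆ s : {s : ℝ≥0 // s ≤ t},
    MeasurableSpace.comap (fun w : ConfigPath vol x₀ α L => w.1 s.1) inferInstance
  mono' := fun _ _ h => iSup_le fun s => le_iSup_of_le ⟨s.1, s.2.trans h⟩ le_rfl
  le' := fun _ => iSup_le fun s => (measurable_eval s.1).comap_le

theorem ConfigPath.measurable_eval_filtration (t : ℝ≥0) :
    Measurable[filtration vol x₀ α L t] fun w : ConfigPath vol x₀ α L => w.1 t :=
  Measurable.mono (comap_measurable _)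
    (le_iSup (fun r : {r : ℝ≥0 // r ≤ t} =>
      MeasurableSpace.comap (fun w : ConfigPath vol x₀ α L => w.1 r.1) inferInstance)
        ⟨t, le_rfl⟩) le_rfl

/-- `Y` maps almost every family of independent paths that start at the points `x n` to the path of
the configuration formed by them. -/
structure IsRealization (P : X → Measure (CadlagPath X)) (x : ℕ → X)
    (Y : (ℕ → CadlagPath X) → ConfigPath vol x₀ α L) : Prop where
  measurable : Measurable Y
  isNumeration : ∀ᵐ w ∂(Measure.infinitePi fun n => P (x n)), ∀ t,
    IsNumeration ((Y w).1 t).1 fun n => (w n).1 t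

end ConfigPath

/-! ### Realization by independent particles -/

section Realization

variable {X : Type u} [MetricSpace X] [LocallyCompactSpace X] [SecondCountableTopology X]
  [CompleteSpace X] [MeasurableSpace X] [BorelSpace X] {vol : Measure X} {x₀ : X} {α : ℝ} {m : ℕ}
  {p : ℝ≥0 → Kernel X X} {P : X → Measure (CadlagPath X)} {L : Prop}

/-- There are countably many pairs, and two different coordinates have a product as their joint law.
-/
theorem ae_infinitePi_pair (hP : ∀ x, IsProbabilityMeasure (P x)) {x : ℕ → X}
    (hx : Function.Injective x) {R : CadlagPath X → CadlagPath X → Prop}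
    (h : ∀ x y, x ≠ y → ∀ᵐ w ∂((P x).prod (P y)), R w.1 w.2) :
    ∀ᵐ w ∂(Measure.infinitePi fun n => P (x n)), ∀ i j, i ≠ j → R (w i) (w j) := by
  refine ae_all_iff.2 fun i => ae_all_iff.2 fun j => ?_
  by_cases hij : i = j
  · exact ae_of_all _ fun _ h => absurd hij h
  have h1 := h (x i) (x j) (hx.ne hij)
  rw [← Measure.infinitePi_map_eval_prod (P := fun n => P (x n)) hij] at h1
  exact (ae_of_ae_map (by fun_prop) h1).mono fun w hw _ => hw

theorem ae_isGoodFamily (hG : GrowthBounds vol x₀ α m) (hα : 1 ≤ α) (hm : 1 ≤ m)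
    (hp : IsMarkovSemigroup p) (hP : IsCadlagMarkovFamily p P) (hmeet : NeverMeet P)
    (hexit : ExitSummable P α m) {γ : Theta vol x₀ α} {x : ℕ → X} (hx : IsNumeration γ.1 x) :
    ∀ᵐ w ∂(Measure.infinitePi fun n => P (x n)), IsGoodFamily x₀ x w := by
  have hprob := hP.isProbabilityMeasure
  have hstart : ∀ᵐ w ∂(Measure.infinitePi fun n => P (x n)), ∀ n, (w n).1 0 = x n :=
    ae_all_iff.2 fun n => (measurePreserving_eval_infinitePi (fun n => P (x n)) n)
      |>.quasiMeasurePreserving.ae (hP.start (x n))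
  filter_upwards [hstart, ae_infinitePi_pair hprob hx.1
      (R := fun v w => ∀ t, 0 < t → v.1 t ≠ w.1 t) hmeet,
    ae_finite_setOf_displacement hG hα hm hp hP hexit hx] with w h0 hw hfin
  refine ⟨h0, fun t i j hij => ?_, hfin⟩
  by_contra hne
  -- The no-meeting assumption is about positive times; at time 0 the starting points are distinct.
  rcases eq_or_ne t 0 with rfl | ht
  · exact hne (hx.1 (by rw [← h0 i, ← h0 j]; exact hij))
  · exact hw i j hne t (pos_iff_ne_zero.2 ht) hij

theorem measurable_eval_paths (t : ℝ≥0) :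
    Measurable fun (w : ℕ → CadlagPath X) n => (w n).1 t :=
  measurable_pi_lambda _ fun n => (measurable_eval_path t).comp (measurable_pi_apply n)

/-- The proposition `L` lets one construction provide left limits in the multiple sense and, if `L`
holds, in `Θ_α`. -/
theorem exists_isRealization (hG : GrowthBounds vol x₀ α m) (hα : 1 ≤ α) (hm : 1 ≤ m)
    (hp : IsMarkovSemigroup p) (hP : IsCadlagMarkovFamily p P) (hmeet : NeverMeet P)
    (hexit : ExitSummable P α m) (hL : L → LeftLimitsNeverMeet P)
    {γ : Theta vol x₀ α} {x : ℕ → X} (hx : IsNumeration γ.1 x) :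
    ∃ Y : (ℕ → CadlagPath X) → ConfigPath vol x₀ α L, IsRealization P x Y := by
  classical
  have hprob := hP.isProbabilityMeasure
  set Q := Measure.infinitePi fun n => P (x n) with hQ
  have hLae : ∀ᵐ w ∂Q, L → ∀ i j, i ≠ j → ∀ t, 0 < t →
      ¬ ∃ z, Tendsto (w i).1 (𝓝[<] t) (𝓝 z) ∧ Tendsto (w j).1 (𝓝[<] t) (𝓝 z) := by
    by_cases h : L
    · exact (ae_infinitePi_pair hprob hx.1 (R := fun v w => ∀ t, 0 < t →
        ¬ ∃ z, Tendsto v.1 (𝓝[<] t) (𝓝 z) ∧ Tendsto w.1 (𝓝[<] t) (𝓝 z)) (hL h)).mono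
        fun w hw _ => hw
    · exact ae_of_all _ fun _ h' => absurd h' h
  -- Measurability of the good event itself is not needed: it contains a measurable set `G` of full
  -- measure.
  obtain ⟨G, hGm, hG1, hGsub⟩ : ∃ G : Set (ℕ → CadlagPath X), MeasurableSet G ∧ (∀ᵐ w ∂Q, w ∈ G) ∧
      ∀ w ∈ G, IsGoodFamily x₀ x w ∧ (L → ∀ i j, i ≠ j → ∀ t, 0 < t →
        ¬ ∃ z, Tendsto (w i).1 (𝓝[<] t) (𝓝 z) ∧ Tendsto (w j).1 (𝓝[<] t) (𝓝 z)) := by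
    obtain ⟨N, hN, hNm, hN0⟩ := exists_measurable_superset_of_null (ae_iff.1
      ((ae_isGoodFamily hG hα hm hp hP hmeet hexit hx).and hLae))
    exact ⟨Nᶜ, hNm.compl, measure_eq_zero_iff_ae_notMem.1 hN0,
      fun w hw => not_not.1 fun h => hw (hN h)⟩
  have hnum : ∀ (w) (hw : w ∈ G) t, IsNumeration
      (toTheta hG ⟨_, (hGsub w hw).1.mem_thetaSeq hG hx t⟩).1 fun n => (w n).1 t :=
    fun w hw t => isNumeration_toTheta hG _
  let Y : (ℕ → CadlagPath X) → ConfigPath vol x₀ α L := fun w =>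
    if hw : w ∈ G then ⟨fun t => toTheta hG ⟨_, (hGsub w hw).1.mem_thetaSeq hG hx t⟩,
      (hGsub w hw).1.isCadlagMultiple hG hx (hnum w hw),
      fun h => (hGsub w hw).1.isCadlag hG hx (hnum w hw) ((hGsub w hw).2 h)⟩
    -- Off `G` a constant path is used, so that every value of `Y` is a regular path.
    else ⟨fun _ => γ, isCadlagMultiple_const hG hx, fun _ => isCadlag_const γ⟩
  have hY : ∀ w ∈ G, ∀ t, IsNumeration ((Y w).1 t).1 fun n => (w n).1 t := by
    intro w hw t
    simp only [Y, dif_pos hw]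
    exact hnum w hw t
  refine ⟨Y, ?_, ?_⟩
  · refine measurable_comap_iff.2 (measurable_pi_iff.2 fun t A hA => ?_)
    have h : (fun w => (Y w).1 t) ⁻¹' A =
        (G ∩ {w | (fun n => (w n).1 t) ∈ numerations A}) ∪ (Gᶜ ∩ {_w | γ ∈ A}) := by
      ext w
      by_cases hw : w ∈ G
      · simpa [hw] using (hY w hw t).mem_numerations_iff.symm
      · simp [hw, Y]
    exact h ▸ (hGm.inter (measurable_eval_paths t (measurableSet_numerations hG hA))).union
      (hGm.compl.inter (MeasurableSet.const _))
  · exact hG1.mono hY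

/-- The right side no longer involves `Y`: uniqueness of the law and its measurable dependence on
the numeration can be read off from it. -/
theorem IsRealization.measure_map {x : ℕ → X}
    {Y : (ℕ → CadlagPath X) → ConfigPath vol x₀ α L} (hY : IsRealization P x Y)
    (I : Finset ℝ≥0) {A : ℝ≥0 → Set (Theta vol x₀ α)} (hA : ∀ i, MeasurableSet (A i)) :
    (Measure.infinitePi fun n => P (x n)).map Y {v | ∀ i ∈ I, v.1 i ∈ A i} =
      (Measure.infinitePi fun n => P (x n))
        {w | ∀ i ∈ I, (fun n => (w n).1 i) ∈ numerations (A i)} := by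
  have hm : MeasurableSet {v : ConfigPath vol x₀ α L | ∀ i ∈ I, v.1 i ∈ A i} := by
    have : {v : ConfigPath vol x₀ α L | ∀ i ∈ I, v.1 i ∈ A i} =
        ⋂ i ∈ I, (fun v : ConfigPath vol x₀ α L => v.1 i) ⁻¹' A i := by
      ext w
      simp
    rw [this]
    exact Finset.measurableSet_biInter _ fun i _ => ConfigPath.measurable_eval _ (hA i)
  rw [Measure.map_apply hY.measurable hm]
  refine measure_congr (hY.isNumeration.mono fun w hw => ?_)
  refine propext (forall₂_congr fun i _ => ?_)
  exact (hw i).mem_numerations_iff.symm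

theorem measurableSet_forall_mem_numerations (hG : GrowthBounds vol x₀ α m) (I : Finset ℝ≥0)
    {A : ℝ≥0 → Set (Theta vol x₀ α)} (hA : ∀ i, MeasurableSet (A i)) :
    MeasurableSet {w : ℕ → CadlagPath X | ∀ i ∈ I,
      (fun n => (w n).1 i) ∈ numerations (A i)} := by
  have : {w : ℕ → CadlagPath X | ∀ i ∈ I, (fun n => (w n).1 i) ∈ numerations (A i)} =
      ⋂ i ∈ I, (fun (w : ℕ → CadlagPath X) n => (w n).1 i) ⁻¹' numerations (A i) := by
    ext w
    simp
  rw [this]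
  exact Finset.measurableSet_biInter _ fun i _ =>
    measurable_eval_paths i (measurableSet_numerations hG (hA i))

/-- Two numerations differ by a permutation, which carries one product measure to the other and
leaves the sets `numerations (A i)` invariant. -/
theorem IsRealization.map_eq (hG : GrowthBounds vol x₀ α m) (hP : ∀ x, IsProbabilityMeasure (P x))
    {γ : Theta vol x₀ α} {x y : ℕ → X} (hx : IsNumeration γ.1 x) (hy : IsNumeration γ.1 y)
    {Y Y' : (ℕ → CadlagPath X) → ConfigPath vol x₀ α L} (hY : IsRealization P x Y)
    (hY' : IsRealization P y Y') :
    (Measure.infinitePi fun n => P (x n)).map Y = (Measure.infinitePi fun n => P (y n)).map Y' := by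
  have := Measure.isProbabilityMeasure_map (μ := Measure.infinitePi fun n => P (x n))
    hY.measurable.aemeasurable
  have := Measure.isProbabilityMeasure_map (μ := Measure.infinitePi fun n => P (y n))
    hY'.measurable.aemeasurable
  refine measure_subtype_pi_ext fun I A hA => ?_
  rw [hY.measure_map I hA, hY'.measure_map I hA]
  obtain ⟨σ, rfl⟩ := hx.exists_equiv hy
  have hmap := Measure.map_infinitePi_infinitePi_of_inj (P := fun n => P (x n)) σ.injective
  simp only [Function.comp_apply]
  rw [← hmap, Measure.map_apply (by fun_prop) (measurableSet_forall_mem_numerations hG I hA)]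
  congr 1
  ext w
  refine forall₂_congr fun i _ => ?_
  exact (comp_equiv_mem_numerations_iff (fun n => (w n).1 i) σ).symm

theorem IsCadlagMarkovFamily.infinitePi_map_eval (hp : IsMarkovSemigroup p)
    (hP : IsCadlagMarkovFamily p P) (x : ℕ → X) (t : ℝ≥0) :
    (Measure.infinitePi fun n => P (x n)).map (fun w n => (w n).1 t) =
      Measure.infinitePi fun n => p t (x n) := by
  have := hP.isProbabilityMeasure
  rw [Measure.infinitePi_map_pi (f := fun _ (w : CadlagPath X) => w.1 t) _
    fun n => measurable_eval_path t]
  simp only [hP.map_eval hp]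

theorem IsRealization.map_eval_apply (hG : GrowthBounds vol x₀ α m) (hp : IsMarkovSemigroup p)
    (hP : IsCadlagMarkovFamily p P) {x : ℕ → X}
    {Y : (ℕ → CadlagPath X) → ConfigPath vol x₀ α L} (hY : IsRealization P x Y) (t : ℝ≥0)
    {A : Set (Theta vol x₀ α)} (hA : MeasurableSet A) :
    (Measure.infinitePi fun n => P (x n)).map Y ((fun v => v.1 t) ⁻¹' A) =
      Measure.infinitePi (fun n => p t (x n)) (numerations A) := by
  have h := hY.measure_map {t} (A := fun _ => A) fun _ => hA
  simp only [Finset.mem_singleton, forall_eq] at h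
  rw [← hP.infinitePi_map_eval hp, Measure.map_apply (measurable_eval_paths t)
    (measurableSet_numerations hG hA)]
  exact h

/-- The `σ`-algebra `σ(w_n(s), s ≤ t, n ∈ ℕ)` on the families of paths. -/
@[reducible]
noncomputable def pathsUntil (X : Type u) [TopologicalSpace X] [MeasurableSpace X] (t : ℝ≥0) :
    MeasurableSpace (ℕ → CadlagPath X) :=
  @MeasurableSpace.pi ℕ (fun _ => CadlagPath X) fun _ => pathFiltration X t

theorem measurable_eval_pathsUntil {s t : ℝ≥0} (h : s ≤ t) :
    Measurable[pathsUntil X t] fun (w : ℕ → CadlagPath X) n => (w n).1 s := by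
  refine @measurable_pi_lambda _ _ _ (pathsUntil X t) _ _ fun n => ?_
  exact (measurable_eval_pathFiltration h).comp
    (@measurable_pi_apply ℕ (fun _ => CadlagPath X) (fun _ => pathFiltration X t) n)

theorem IsRealization.markov (hG : GrowthBounds vol x₀ α m) (hp : IsMarkovSemigroup p)
    (hP : IsCadlagMarkovFamily p P) {x : ℕ → X}
    {Y : (ℕ → CadlagPath X) → ConfigPath vol x₀ α L} (hY : IsRealization P x Y)
    {T : ℝ≥0 → Kernel (Theta vol x₀ α) (Theta vol x₀ α)} [∀ t, IsMarkovKernel (T t)]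
    (hT : ∀ t (γ : Theta vol x₀ α) (y : ℕ → X), IsNumeration γ.1 y → ∀ A, MeasurableSet A →
      T t γ A = Measure.infinitePi (fun n => p t (y n)) (numerations A)) :
    HasMarkovProperty (ConfigPath.filtration vol x₀ α L) (fun t w => w.1 t) T
      ((Measure.infinitePi fun n => P (x n)).map Y) := by
  have := hP.isProbabilityMeasure
  have := hp.isMarkovKernel
  have := Measure.isProbabilityMeasure_map (μ := Measure.infinitePi fun n => P (x n))
    hY.measurable.aemeasurable
  refine hasMarkovProperty_of_measure_inter ConfigPath.measurable_eval_filtration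
    fun s t B hB A hA => ?_
  set Q := Measure.infinitePi fun n => P (x n) with hQ
  -- `Y` need not be adapted, since membership in `G` involves the entire paths. Its past events
  -- agree only almost surely with past events of the particles, so the latter are completed by null
  -- sets.
  have hle : ConfigPath.filtration vol x₀ α L s ≤
      MeasurableSpace.map Y (eventuallyMeasurableSpace (pathsUntil X s) (ae Q)) := by
    refine iSup_le fun r => ?_
    rintro _ ⟨A, hA, rfl⟩
    refine ⟨(fun (w : ℕ → CadlagPath X) n => (w n).1 r.1) ⁻¹' numerations A, ?_, ?_⟩
    · exact measurable_eval_pathsUntil r.2 (measurableSet_numerations hG hA)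
    · refine hY.isNumeration.mono fun w hw => propext ?_
      exact (hw r.1).mem_numerations_iff.symm
  obtain ⟨B', hB', hBB'⟩ := hle B hB
  have hBm : MeasurableSet B := (ConfigPath.filtration vol x₀ α L).le s _ hB
  have hm : Measurable fun w : ConfigPath vol x₀ α L => T t (w.1 s) A :=
    ((T t).measurable_coe hA).comp (ConfigPath.measurable_eval s)
  have hprod := measure_infinitePi_inter (Q := fun n => P (x n)) ((pathFiltration X).le s)
    (measurable_eval_path s) (measurable_eval_path (s + t)) (κ := p t)
    (fun n B hB A hA => (hP.markov (x n)).measure_inter (fun t => measurable_eval_path t) t hB hA)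
    hB' (measurableSet_numerations hG hA)
  rw [Measure.map_apply hY.measurable (hBm.inter (ConfigPath.measurable_eval _ hA)),
    setLIntegral_map hBm hm hY.measurable]
  calc Q (Y ⁻¹' (B ∩ (fun w => w.1 (s + t)) ⁻¹' A))
      = Q (B' ∩ {w | (fun n => (w n).1 (s + t)) ∈ numerations A}) := by
        refine measure_congr ?_
        rw [preimage_inter]
        refine hBB'.inter (hY.isNumeration.mono fun w hw => propext ?_)
        exact (hw (s + t)).mem_numerations_iff.symm
    _ = ∫⁻ w in B', Measure.infinitePi (fun n => p t ((w n).1 s)) (numerations A) ∂Q := hprod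
    _ = ∫⁻ w in Y ⁻¹' B, Measure.infinitePi (fun n => p t ((w n).1 s)) (numerations A) ∂Q :=
        (setLIntegral_congr hBB').symm
    _ = ∫⁻ w in Y ⁻¹' B, T t ((Y w).1 s) A ∂Q := by
        refine lintegral_congr_ae (ae_restrict_of_ae (hY.isNumeration.mono fun w hw => ?_))
        exact (hT t _ _ (hw s) A hA).symm

end Realization

/-! ### Construction of the semigroup and of the Markov process -/

section Existence

variable {X : Type u} [MetricSpace X] [LocallyCompactSpace X] [SecondCountableTopology X]
  [CompleteSpace X] [MeasurableSpace X] [BorelSpace X] {vol : Measure X} {x₀ : X} {α : ℝ} {m : ℕ}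
  {p : ℝ≥0 → Kernel X X} {P : X → Measure (CadlagPath X)}

theorem configMeasure_apply (ν : ℕ → Measure X) {A : Set (Config X)} (hA : MeasurableSet A) :
    configMeasure ν A = Measure.infinitePi ν (Subtype.val '' (toConfig ⁻¹' A)) := by
  rw [configMeasure, Measure.map_apply measurable_toConfig hA,
    Measure.comap_apply _ Subtype.val_injective
      (fun s hs => measurableSet_goodSeq.subtype_image hs) _ (measurable_toConfig hA)]

theorem numerations_preimage_eq (hG : GrowthBounds vol x₀ α m) (A : Set (Config X)) :
    numerations (Subtype.val ⁻¹' A : Set (Theta vol x₀ α)) =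
      (Subtype.val '' (toConfig ⁻¹' A)) ∩ thetaSeq vol x₀ α := by
  ext y
  constructor
  · rintro ⟨γ, hγ, h⟩
    refine ⟨⟨⟨y, thetaSeq_subset_goodSeq hG h.mem_thetaSeq⟩, ?_, rfl⟩, h.mem_thetaSeq⟩
    have : toConfig ⟨y, thetaSeq_subset_goodSeq hG h.mem_thetaSeq⟩ = γ.1 := Subtype.ext h.2
    rw [mem_preimage, this]
    exact hγ
  · rintro ⟨⟨z, hz, rfl⟩, hy⟩
    exact ⟨toTheta hG ⟨z.1, hy⟩, hz, isNumeration_toTheta hG _⟩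

theorem exists_independent_process (hG : GrowthBounds vol x₀ α m) (hα : 1 ≤ α) (hm : 1 ≤ m)
    (hp : IsMarkovSemigroup p) (hP : IsCadlagMarkovFamily p P) (hmeet : NeverMeet P)
    (hexit : ExitSummable P α m) :
    ∃ T : ℝ≥0 → Kernel (Theta vol x₀ α) (Theta vol x₀ α),
      IsMarkovSemigroup T ∧ IsIndependentTransition p T ∧
      ∃ M : MarkovProcess (Theta vol x₀ α) T, IsIndependentRealization P M ∧
        (∀ w, IsCadlagMultiple vol x₀ α fun t => M.X t w) ∧
        (LeftLimitsNeverMeet P → ∀ w, IsCadlag fun t => M.X t w) := by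
  have hprob := hP.isProbabilityMeasure
  have hpm := hp.isMarkovKernel
  obtain ⟨N, hNm, hN, -⟩ := exists_measurable_numeration hG
  -- Taking `L` to be the hypothesis of (c) itself, one path space and one process serve for (b) and
  -- (c).
  have hreal : ∀ (γ : Theta vol x₀ α) (x : ℕ → X), IsNumeration γ.1 x →
      ∃ Y : (ℕ → CadlagPath X) → ConfigPath vol x₀ α (LeftLimitsNeverMeet P),
        IsRealization P x Y := fun γ x hx =>
    exists_isRealization hG hα hm hp hP hmeet hexit id hx
  choose Y hY using fun γ => hreal γ (N γ) (hN γ)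
  let law : Theta vol x₀ α → Measure (ConfigPath vol x₀ α (LeftLimitsNeverMeet P)) := fun γ =>
    (Measure.infinitePi fun n => P (N γ n)).map (Y γ)
  have hlaw : ∀ γ, IsProbabilityMeasure (law γ) := fun γ =>
    Measure.isProbabilityMeasure_map (hY γ).measurable.aemeasurable
  have hlawm : Measurable law := by
    refine measurable_measure_subtype_pi fun I A hA => ?_
    simp only [law, (hY _).measure_map I hA]
    exact (Measure.measurable_coe (measurableSet_forall_mem_numerations hG I hA)).comp
      ((measurable_infinitePi (hP.measurable hp)).comp hNm)
  -- The kernels are defined as marginals of the laws; the product formula `hT` and the semigroup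
  -- property are derived afterwards.
  let T : ℝ≥0 → Kernel (Theta vol x₀ α) (Theta vol x₀ α) := fun t =>
    ⟨fun γ => (law γ).map fun w : ConfigPath vol x₀ α (LeftLimitsNeverMeet P) => w.1 t,
      (Measure.measurable_map _ (ConfigPath.measurable_eval t)).comp hlawm⟩
  have hTlaw : ∀ t γ A, MeasurableSet A → T t γ A = law γ ((fun w => w.1 t) ⁻¹' A) :=
    fun t γ A hA => Measure.map_apply (ConfigPath.measurable_eval t) hA
  have hTm : ∀ t, IsMarkovKernel (T t) := fun t =>
    ⟨fun γ => Measure.isProbabilityMeasure_map (ConfigPath.measurable_eval t).aemeasurable⟩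
  have hT : ∀ t (γ : Theta vol x₀ α) (y : ℕ → X), IsNumeration γ.1 y → ∀ A, MeasurableSet A →
      T t γ A = Measure.infinitePi (fun n => p t (y n)) (numerations A) := by
    intro t γ y hy A hA
    obtain ⟨Y', hY'⟩ := hreal γ y hy
    rw [hTlaw t γ A hA, ← hY'.map_eval_apply hG hp hP t hA]
    exact congrArg (fun μ => μ ((fun w => w.1 t) ⁻¹' A))
      ((hY γ).map_eq hG hprob (hN γ) hy hY')
  have hmarkov : ∀ γ, HasMarkovProperty (ConfigPath.filtration vol x₀ α (LeftLimitsNeverMeet P))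
      (fun t w => w.1 t) T (law γ) := fun γ => (hY γ).markov hG hp hP hT
  have hstart : ∀ γ, ∀ᵐ w ∂(law γ), w.1 0 = γ := by
    intro γ
    have h0 : ∀ᵐ w ∂(Measure.infinitePi fun n => P (N γ n)), ((Y γ) w).1 0 = γ := by
      have hs : ∀ᵐ w ∂(Measure.infinitePi fun n => P (N γ n)), ∀ n, (w n).1 0 = N γ n :=
        ae_all_iff.2 fun n => (measurePreserving_eval_infinitePi (fun n => P (N γ n)) n)
          |>.quasiMeasurePreserving.ae (hP.start (N γ n))
      filter_upwards [hs, (hY γ).isNumeration] with w hw hnum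
      have h := hnum 0
      simp only [hw] at h
      exact Subtype.ext (h.eq (hN γ))
    have hγ : MeasurableSet {γ} := by
      have : {γ} = Subtype.val ⁻¹' {γ.1} := by
        ext γ'
        exact Subtype.ext_iff
      exact this ▸ measurable_subtype_coe (measurableSet_singleton_config γ.1)
    exact (ae_map_iff (hY γ).measurable.aemeasurable (ConfigPath.measurable_eval 0 hγ)).2 h0
  refine ⟨T, ⟨hTm, ?_, fun s t => ?_⟩, ?_, ?_⟩
  · ext γ A hA
    rw [hTlaw 0 γ A hA, Kernel.id_apply, Measure.dirac_apply' _ hA]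
    have h : (fun w : ConfigPath vol x₀ α (LeftLimitsNeverMeet P) => w.1 0) ⁻¹' A =ᵐ[law γ]
        {_w | γ ∈ A} := (hstart γ).mono fun w hw => by
      change (w.1 0 ∈ A) = (γ ∈ A)
      rw [hw]
    rw [measure_congr h]
    by_cases hγ : γ ∈ A <;> simp [hγ]
  -- Chapman-Kolmogorov is the Markov property on the event `univ`.
  · ext γ A hA
    have h := (hmarkov γ).measure_inter (fun t => ConfigPath.measurable_eval t) (s := s) t
      MeasurableSet.univ hA
    rw [univ_inter, Measure.restrict_univ] at h
    rw [hTlaw _ γ A hA, h, Kernel.comp_apply' _ _ _ hA]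
    exact (lintegral_map ((T t).measurable_coe hA) (ConfigPath.measurable_eval s)).symm
  · intro t γ x hx
    ext A hA
    rw [Measure.map_apply measurable_subtype_coe hA, configMeasure_apply _ hA,
      hT t γ x hx _ (measurable_subtype_coe hA), numerations_preimage_eq hG]
    -- The image measure in `IsIndependentTransition` lives on all of `Config X`. The product
    -- measure is carried by `thetaSeq`, because `T t γ` has total mass one.
    have hae : ∀ᵐ y ∂(Measure.infinitePi fun n => p t (x n)), y ∈ thetaSeq vol x₀ α := by
      refine (mem_ae_iff_prob_eq_one measurableSet_thetaSeq).2 ?_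
      rw [← numerations_univ hG, ← hT t γ x hx _ MeasurableSet.univ, measure_univ]
    refine measure_congr (hae.mono fun y hy => propext ?_)
    exact ⟨fun h => h.1, fun h => ⟨h, hy⟩⟩
  · let M : MarkovProcess (Theta vol x₀ α) T :=
      { Ω := ConfigPath vol x₀ α (LeftLimitsNeverMeet P)
        events := inferInstance
        filtration := ConfigPath.filtration vol x₀ α (LeftLimitsNeverMeet P)
        shift := ConfigPath.shift
        law := law
        X := fun t w => w.1 t
        adapted := ConfigPath.measurable_eval_filtration
        measurable_shift := ConfigPath.measurable_shift
        X_shift := fun s t w => by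
          change w.1 (t + s) = w.1 (s + t)
          rw [add_comm]
        isProbabilityMeasure := hlaw
        measurable_law := fun B hB => (Measure.measurable_coe hB).comp hlawm
        start := hstart
        transition := fun t γ A hA => (hTlaw t γ A hA).symm
        markov := hmarkov }
    refine ⟨M, fun γ x hx => ?_, fun w => w.2.1, fun h w => w.2.2 h⟩
    obtain ⟨Y', hY'⟩ := hreal γ x hx
    refine ⟨fun w => (Y' w).1, measurable_subtype_coe.comp hY'.measurable, hY'.isNumeration, ?_⟩
    have h := hY'.map_eq hG hprob hx (hN γ) (hY γ)
    change _ = (law γ).map Subtype.val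
    rw [show law γ = _ from h.symm, Measure.map_map measurable_subtype_coe hY'.measurable]
    rfl

end Existence

end InfiniteParticles

/-! ### The theorem for Riemannian manifolds -/

theorem mainTheorem1
    {d : ℕ} {X : Type u} [MetricSpace X] [ChartedSpace (EuclideanSpace ℝ (Fin d)) X]
    [SecondCountableTopology X] [IsManifold (𝓡 d) ((⊤ : ℕ∞) : WithTop ℕ∞) X]
    [RiemannianBundle (fun x : X => TangentSpace (𝓡 d) x)]
    [IsContMDiffRiemannianBundle (𝓡 d) ((⊤ : ℕ∞) : WithTop ℕ∞) (EuclideanSpace ℝ (Fin d))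
      (fun x : X => TangentSpace (𝓡 d) x)]
    [IsRiemannianManifold (𝓡 d) X] [ConnectedSpace X] [CompleteSpace X]
    [MeasurableSpace X] [BorelSpace X]
    (hvol : InfiniteParticles.riemannianVolume d X univ = ⊤)
    (x₀ : X) (m : ℕ) (hm : 1 ≤ m) (C : ℝ) (hC : 0 < C)
    (hdoubling : ∀ r β : ℝ, 0 < r → 1 ≤ β →
      InfiniteParticles.riemannianVolume d X (Metric.closedBall x₀ (β * r)) ≤
        ENNReal.ofReal (C * β ^ m) *
          InfiniteParticles.riemannianVolume d X (Metric.closedBall x₀ r))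
    (α : ℝ) (hα : 1 ≤ α)
    (p : ℝ≥0 → Kernel X X) (hp : InfiniteParticles.IsMarkovSemigroup p)
    (P : X → Measure (InfiniteParticles.CadlagPath X))
    (hP : InfiniteParticles.IsCadlagMarkovFamily p P)
    (hmeet : InfiniteParticles.NeverMeet P)
    (hexit : InfiniteParticles.ExitSummable P α m) :
    ∃ T : ℝ≥0 → Kernel
          (InfiniteParticles.Theta (InfiniteParticles.riemannianVolume d X) x₀ α)
          (InfiniteParticles.Theta (InfiniteParticles.riemannianVolume d X) x₀ α),
      InfiniteParticles.IsMarkovSemigroup T ∧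
      InfiniteParticles.IsIndependentTransition p T ∧
      ∃ M : InfiniteParticles.MarkovProcess
          (InfiniteParticles.Theta (InfiniteParticles.riemannianVolume d X) x₀ α) T,
        InfiniteParticles.IsIndependentRealization P M ∧
        (∀ w, InfiniteParticles.IsCadlagMultiple (InfiniteParticles.riemannianVolume d X) x₀ α
          fun t => M.X t w) ∧
        (InfiniteParticles.LeftLimitsNeverMeet P →
          ∀ w, InfiniteParticles.IsCadlag fun t => M.X t w) := by
  have : LocallyCompactSpace X := ChartedSpace.locallyCompactSpace (EuclideanSpace ℝ (Fin d)) X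
  exact InfiniteParticles.exists_independent_process
    (InfiniteParticles.growthBounds_of_doubling hC hα hvol
      (InfiniteParticles.exists_riemannianVolume_closedBall_lt_top x₀) hdoubling)
    hα hm hp hP hmeet hexit
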